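/- Let $\mathbb K$ be an algebraically closed field of characteristic $0$. Let $\boxtimes$ be the Lie algebra over $\mathbb K$ with generators $X_{rs}$ ($r,s\in\{0,1,2,3\}$, $r\neq s$) and relations $X_{rs}+X_{sr}=0$ for distinct $r,s$; $[X_{rs},X_{st}]=2X_{rs}+2X_{st}$ for mutually distinct $r,s,t$; $[X_{rs},[X_{rs},[X_{rs},X_{tu}]]]=4[X_{rs},X_{tu}]$ for mutually distinct $r,s,t,u$. Let $\mathcal O$ be the Lie algebra over $\mathbb K$ with generators $X,Y$ and relations $[X,[X,[X,Y]]]=4[X,Y]$, $[Y,[Y,[Y,X]]]=4[Y,X]$. A finite-dimensional irreducible $\mathcal O$-module has *type $(0,0)$ and diameter $d$* if the set of distinct eigenvalues of $X$ on it, and likewise that of $Y$, is $\{d-2i : 0\le i\le d\}$; it has *type $(0,0)$* if this holds for some integer $d\ge 0$. A *tridiagonal pair* on a nonzero finite-dimensional vector space $V$ is a pair $A,A^*$ of diagonalizable linear maps $V\to V$, leaving no common subspace other than $0$ and $V$ invariant, such that the eigenspaces of $A$ can be ordered $V_0,\dots,V_d$ with $A^*V_i\subseteq V_{i-1}+V_i+V_{i+1}$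 for all $i$ (where $V_{-1}=V_{d+1}=0$), and the same holds with $A,A^*$ exchanged (possibly with another number of eigenspaces). A *decomposition* of $V$ of diameter $d$ is a sequence $U_0,\dots,U_d$ of nonzero subspaces with $V=U_0\oplus\cdots\oplus U_d$; it *induces* the sequence with $i$-th component $U_0+\cdots+U_i$. A *flag* on $V$ of diameter $d$ is a sequence $F_0\subseteq\cdots\subseteq F_d=V$ of mutually distinct subspaces with $F_0\ne 0$. Flags $F,G$ of diameter $d$ are *opposite* if some decomposition $U_0,\dots,U_d$ induces $F$ while $U_d,\dots,U_0$ induces $G$; this decomposition is then said to be induced by $F,G$. **Theorem.** (1) Let $V$ be a finite-dimensional irreducible $\mathcal O$-module of type $(0,0)$ and diameter $d$, and let $A,A^*$ be the actions of $X,Y$ on $V$. (a) There is a unique $\boxtimes$-module structure on $V$ in which $X_{01},X_{23}$ act as $A,A^*$ respectively, and this $\boxtimes$-module structure is irreducible. (b) $A,A^*$ is a tridiagonal pair on $V$. With $V_A(\lambda)=\{v\in V: Av=\lambda v\}$, and similarly for $A^*$, the four sequences of subspaces, numbered $0,1,2,3$, with $i$-th components ($0\le i\le d$) $$V_A(-d)+\cdots+V_A(2i-d),\quad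 V_A(d)+\cdots+V_A(d-2i),\quad V_{A^*}(-d)+\cdots+V_{A^*}(2i-d),\quad V_{A^*}(d)+\cdots+V_{A^*}(d-2i)$$ are mutually opposite flags on $V$ of diameter $d$. (c) For all distinct $r,s\in\{0,1,2,3\}$ there is a unique linear map $x_{rs}:V\to V$ such that, $U_0,\dots,U_d$ being the decomposition induced by flags $r$ and $s$, the eigenspace of $x_{rs}$ for the eigenvalue $2i-d$ is $U_i$ for $0\le i\le d$. There is a unique $\boxtimes$-module structure on $V$ in which $X_{rs}$ acts as $x_{rs}$ for all distinct $r,s$, and it is the structure of (a). (2) There is a bijection from the set of isomorphism classes of finite-dimensional irreducible $\mathcal O$-modules of type $(0,0)$ to the set of isomorphism classes of finite-dimensional irreducible $\boxtimes$-modules such that, for every such $\mathcal O$-module $U$ and $\boxtimes$-module $V$, the class of $U$ is sent to the class of $V$ if and only if there is a linear bijection $f:U\to V$ with $f(Xa)=X_{01}f(a)$ and $f(Ya)=X_{23}f(a)$ for all $a\in U$. -/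

import Mathlib

universe u v w

/-! ### Module structures on a fixed vector space -/

/-- An `L`-module structure on the vector space `V`, for a Lie algebra `L` over `K`. -/
structure LieModuleStructure (K : Type u) (L : Type w) (V : Type v) [CommRing K] [LieRing L]
    [LieAlgebra K L] [AddCommGroup V] [Module K V] where
  [lieRingModule : LieRingModule L V]
  [lieModule : LieModule K L V]

namespace LieModuleStructure

variable {K : Type u} {L : Type w} {V : Type v} [CommRing K] [LieRing L] [LieAlgebra K L]
  [AddCommGroup V] [Module K V]

/-- The linear map by which `x : L` acts on `V` in the given module structure. -/
def act (S : LieModuleStructure K L V) (x : L) : Module.End K V :=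
  letI := S.lieRingModule
  letI := S.lieModule
  LieModule.toEnd K L V x

/-- The given module structure is irreducible (in particular `V ≠ 0`). -/
def IsIrreducible (S : LieModuleStructure K L V) : Prop :=
  letI := S.lieRingModule
  letI := S.lieModule
  LieModule.IsIrreducible K L V

end LieModuleStructure

/-! ### The tetrahedron algebra -/

namespace Tetrahedron

/-- Ordered pairs of distinct elements of `{0, 1, 2, 3}`. -/
abbrev Index : Type := {p : Fin 4 × Fin 4 // p.1 ≠ p.2}

/-- The free generators. -/
noncomputable def freeGen (K : Type u) [CommRing K] (r s : Fin 4) (h : r ≠ s) : FreeLieAlgebra K Index :=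
  FreeLieAlgebra.of K ⟨(r, s), h⟩

/-- The defining relators of the tetrahedron algebra. -/
inductive IsRelator (K : Type u) [CommRing K] : FreeLieAlgebra K Index → Prop
  | skew (r s : Fin 4) (h : r ≠ s) :
      IsRelator K (freeGen K r s h + freeGen K s r h.symm)
  | triangle (r s t : Fin 4) (hrs : r ≠ s) (hst : s ≠ t) (hrt : r ≠ t) :
      IsRelator K (⁅freeGen K r s hrs, freeGen K s t hst⁆ -
        ((2 : K) • freeGen K r s hrs + (2 : K) • freeGen K s t hst))
  | dolanGrady (r s t u : Fin 4) (hrs : r ≠ s) (hrt : r ≠ t) (hru : r ≠ u) (hst : s ≠ t)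
      (hsu : s ≠ u) (htu : t ≠ u) :
      IsRelator K
        (⁅freeGen K r s hrs, ⁅freeGen K r s hrs, ⁅freeGen K r s hrs, freeGen K t u htu⁆⁆⁆ -
          (4 : K) • ⁅freeGen K r s hrs, freeGen K t u htu⁆)

/-- The ideal generated by the relators. -/
noncomputable def relIdeal (K : Type u) [CommRing K] : LieIdeal K (FreeLieAlgebra K Index) :=
  LieSubmodule.lieSpan K (FreeLieAlgebra K Index) {a | IsRelator K a}

end Tetrahedron

/-- The tetrahedron Lie algebra, by generators and relations. -/
def Tetrahedron (K : Type u) [CommRing K] : Type u :=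
  FreeLieAlgebra K Tetrahedron.Index ⧸ Tetrahedron.relIdeal K

namespace Tetrahedron

noncomputable instance (K : Type u) [CommRing K] : LieRing (Tetrahedron K) :=
  inferInstanceAs (LieRing (FreeLieAlgebra K Index ⧸ relIdeal K))

noncomputable instance (K : Type u) [CommRing K] : LieAlgebra K (Tetrahedron K) :=
  inferInstanceAs (LieAlgebra K (FreeLieAlgebra K Index ⧸ relIdeal K))

/-- The generator `X_{rs}`. -/
noncomputable def gen (K : Type u) [CommRing K] (r s : Fin 4) (h : r ≠ s) : Tetrahedron K :=
  LieSubmodule.Quotient.mk (N := relIdeal K) (freeGen K r s h)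

/-- The generator `X_{01}`. -/
noncomputable def X01 (K : Type u) [CommRing K] : Tetrahedron K := gen K 0 1 (by decide)

/-- The generator `X_{23}`. -/
noncomputable def X23 (K : Type u) [CommRing K] : Tetrahedron K := gen K 2 3 (by decide)

end Tetrahedron

/-! ### The Onsager algebra -/

namespace Onsager

/-- The free generator `X` is `freeGen K 0`, the free generator `Y` is `freeGen K 1`. -/
noncomputable def freeGen (K : Type u) [CommRing K] (i : Fin 2) : FreeLieAlgebra K (Fin 2) :=
  FreeLieAlgebra.of K i

/-- The Dolan-Grady relators `[a,[a,[a,b]]] - 4[a,b]`, for `(a,b) = (X,Y)` and `(Y,X)`. -/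
inductive IsRelator (K : Type u) [CommRing K] : FreeLieAlgebra K (Fin 2) → Prop
  | xy : IsRelator K
      (⁅freeGen K 0, ⁅freeGen K 0, ⁅freeGen K 0, freeGen K 1⁆⁆⁆ -
        (4 : K) • ⁅freeGen K 0, freeGen K 1⁆)
  | yx : IsRelator K
      (⁅freeGen K 1, ⁅freeGen K 1, ⁅freeGen K 1, freeGen K 0⁆⁆⁆ -
        (4 : K) • ⁅freeGen K 1, freeGen K 0⁆)

/-- The ideal generated by the relators. -/
noncomputable def relIdeal (K : Type u) [CommRing K] : LieIdeal K (FreeLieAlgebra K (Fin 2)) :=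
  LieSubmodule.lieSpan K (FreeLieAlgebra K (Fin 2)) {a | IsRelator K a}

end Onsager

/-- The Onsager Lie algebra, by generators and relations. -/
def Onsager (K : Type u) [CommRing K] : Type u :=
  FreeLieAlgebra K (Fin 2) ⧸ Onsager.relIdeal K

namespace Onsager

noncomputable instance (K : Type u) [CommRing K] : LieRing (Onsager K) :=
  inferInstanceAs (LieRing (FreeLieAlgebra K (Fin 2) ⧸ relIdeal K))

noncomputable instance (K : Type u) [CommRing K] : LieAlgebra K (Onsager K) :=
  inferInstanceAs (LieAlgebra K (FreeLieAlgebra K (Fin 2) ⧸ relIdeal K))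

/-- The standard generator `X`. -/
noncomputable def X (K : Type u) [CommRing K] : Onsager K :=
  LieSubmodule.Quotient.mk (N := relIdeal K) (freeGen K 0)

/-- The standard generator `Y`. -/
noncomputable def Y (K : Type u) [CommRing K] : Onsager K :=
  LieSubmodule.Quotient.mk (N := relIdeal K) (freeGen K 1)

/-- The `Onsager K`-module `V` has type `(α, β)` and diameter `d`: the distinct eigenvalues of `X`
are the `d - 2i + α` and those of `Y` are the `d - 2i + β`, `0 ≤ i ≤ d`. -/
def HasTypeDiameter (K : Type u) (V : Type v) [Field K] [AddCommGroup V] [Module K V]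
    [LieRingModule (Onsager K) V] [LieModule K (Onsager K) V] (α β : K) (d : ℕ) : Prop :=
  {μ : K | (LieModule.toEnd K (Onsager K) V (X K)).HasEigenvalue μ} =
      {μ : K | ∃ i : ℕ, i ≤ d ∧ μ = (d : K) - 2 * (i : K) + α} ∧
  {μ : K | (LieModule.toEnd K (Onsager K) V (Y K)).HasEigenvalue μ} =
      {μ : K | ∃ i : ℕ, i ≤ d ∧ μ = (d : K) - 2 * (i : K) + β}

/-- The `Onsager K`-module `V` has type `(α, β)`. -/
def HasType (K : Type u) (V : Type v) [Field K] [AddCommGroup V] [Module K V]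
    [LieRingModule (Onsager K) V] [LieModule K (Onsager K) V] (α β : K) : Prop :=
  ∃ d : ℕ, HasTypeDiameter K V α β d

end Onsager

/-! ### Tridiagonal pairs, flags and decompositions -/

section LinearAlgebra

variable {K : Type u} {V : Type v} [Field K] [AddCommGroup V] [Module K V]

/-- `A` is diagonalizable: `V` is the sum of the eigenspaces of `A`. -/
def EndDiagonalizable (A : Module.End K V) : Prop :=
  ⨆ μ : K, A.eigenspace μ = ⊤

/-- `θ 0, …, θ d` lists the distinct eigenvalues of `A`, each once, and for the corresponding
ordering `V_0, …, V_d` of the eigenspaces one has `B V_i ⊆ V_{i-1} + V_i + V_{i+1}`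
(with `V_{-1} = V_{d+1} = 0`). -/
def IsStandardEigenvalueSeq (A B : Module.End K V) (d : ℕ) (θ : Fin (d + 1) → K) : Prop :=
  Function.Injective θ ∧ Set.range θ = {μ : K | A.HasEigenvalue μ} ∧
  ∀ i : Fin (d + 1), (A.eigenspace (θ i)).map B ≤
    ⨆ j : Fin (d + 1), ⨆ _ : (j : ℕ) ≤ (i : ℕ) + 1 ∧ (i : ℕ) ≤ (j : ℕ) + 1, A.eigenspace (θ j)

/-- `A, B` is a tridiagonal pair on `V`. -/
def IsTridiagonalPair (A B : Module.End K V) : Prop :=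
  EndDiagonalizable A ∧ EndDiagonalizable B ∧
  (∃ (d : ℕ) (θ : Fin (d + 1) → K), IsStandardEigenvalueSeq A B d θ) ∧
  (∃ (δ : ℕ) (θ : Fin (δ + 1) → K), IsStandardEigenvalueSeq B A δ θ) ∧
  ¬ ∃ W : Submodule K V, W.map A ≤ W ∧ W.map B ≤ W ∧ W ≠ ⊥ ∧ W ≠ ⊤

/-- `F 0, …, F d` is a flag on `V` of diameter `d`. -/
def IsFlag {d : ℕ} (F : Fin (d + 1) → Submodule K V) : Prop :=
  Function.Injective F ∧ F 0 ≠ ⊥ ∧ Monotone F ∧ F (Fin.last d) = ⊤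

/-- `U 0, …, U d` is a decomposition of `V` of diameter `d`: nonzero subspaces (of any dimension)
whose direct sum is `V`. -/
def IsDecomposition {d : ℕ} (U : Fin (d + 1) → Submodule K V) : Prop :=
  (∀ i, U i ≠ ⊥) ∧ DirectSum.IsInternal U

/-- The flag `U 0 + ⋯ + U i` induced by `U`. -/
def inducedFlag {d : ℕ} (U : Fin (d + 1) → Submodule K V) : Fin (d + 1) → Submodule K V :=
  fun i => ⨆ j : Fin (d + 1), ⨆ _ : j ≤ i, U j

/-- `U` is a decomposition inducing `F`, and its inversion induces `G`. -/
def IsInducedDecomposition {d : ℕ} (F G U : Fin (d + 1) → Submodule K V) : Prop :=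
  IsDecomposition U ∧ F = inducedFlag U ∧ G = inducedFlag (fun i => U i.rev)

/-- The flags `F` and `G` are opposite. -/
def OppositeFlags {d : ℕ} (F G : Fin (d + 1) → Submodule K V) : Prop :=
  ∃ U : Fin (d + 1) → Submodule K V, IsInducedDecomposition F G U

/-- The four flags attached to `A, B`:
flag `0` is `V_A(-d) + ⋯ + V_A(2i-d)`, flag `1` is `V_A(d) + ⋯ + V_A(d-2i)`, and flags `2`, `3`
are the same for `B` in place of `A`. -/
def pairFlag (A B : Module.End K V) (d : ℕ) (r : Fin 4) : Fin (d + 1) → Submodule K V :=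
  ![inducedFlag (fun j : Fin (d + 1) => A.eigenspace (2 * ((j : ℕ) : K) - (d : K))),
    inducedFlag (fun j : Fin (d + 1) => A.eigenspace ((d : K) - 2 * ((j : ℕ) : K))),
    inducedFlag (fun j : Fin (d + 1) => B.eigenspace (2 * ((j : ℕ) : K) - (d : K))),
    inducedFlag (fun j : Fin (d + 1) => B.eigenspace ((d : K) - 2 * ((j : ℕ) : K)))] r

/-- `x` is the linear map attached to the opposite flags `F, G`: for the decomposition
`U 0, …, U d` induced by `F, G`, the eigenspace of `x` with eigenvalue `2i - d` is `U i`. -/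
def IsFlagMap {d : ℕ} (F G : Fin (d + 1) → Submodule K V) (x : Module.End K V) : Prop :=
  ∃ U : Fin (d + 1) → Submodule K V, IsInducedDecomposition F G U ∧
    ∀ i : Fin (d + 1), x.eigenspace (2 * ((i : ℕ) : K) - (d : K)) = U i

end LinearAlgebra

/-! ### Isomorphism classes of modules -/

/-- A finite-dimensional irreducible `L`-module over `K`. -/
structure FinIrrModule (K : Type u) (L : Type w) [Field K] [LieRing L] [LieAlgebra K L] where
  carrier : Type v
  [addCommGroup : AddCommGroup carrier]
  [module : Module K carrier]
  [lieRingModule : LieRingModule L carrier]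
  [lieModule : LieModule K L carrier]
  [finite : FiniteDimensional K carrier]
  [irreducible : LieModule.IsIrreducible K L carrier]

namespace FinIrrModule

attribute [instance] addCommGroup module lieRingModule lieModule finite irreducible

/-- Isomorphism of `L`-modules. -/
instance isoSetoid (K : Type u) (L : Type w) [Field K] [LieRing L] [LieAlgebra K L] :
    Setoid (FinIrrModule.{u, v, w} K L) where
  r M N := Nonempty (M.carrier ≃ₗ⁅K, L⁆ N.carrier)
  iseqv :=
    { refl := fun _ => ⟨LieModuleEquiv.refl⟩
      symm := fun ⟨e⟩ => ⟨e.symm⟩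
      trans := fun ⟨e⟩ ⟨f⟩ => ⟨e.trans f⟩ }

end FinIrrModule

/-- Finite-dimensional irreducible modules for the tetrahedron algebra. -/
abbrev TetrahedronIrr (K : Type u) [Field K] : Type (max u (v + 1)) :=
  FinIrrModule.{u, v, u} K (Tetrahedron K)

/-- Finite-dimensional irreducible modules of type `(0,0)` for the Onsager algebra. -/
abbrev OnsagerIrr (K : Type u) [Field K] : Type (max u (v + 1)) :=
  {M : FinIrrModule.{u, v, u} K (Onsager K) // Onsager.HasType K M.carrier 0 0}

/-- Isomorphism classes of finite-dimensional irreducible tetrahedron modules. -/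
abbrev TetrahedronIsoClass (K : Type u) [Field K] : Type (max u (v + 1)) :=
  Quotient (FinIrrModule.isoSetoid.{u, v, u} K (Tetrahedron K))

/-- Isomorphism classes of finite-dimensional irreducible Onsager modules of type `(0,0)`. -/
abbrev OnsagerIsoClass (K : Type u) [Field K] : Type (max u (v + 1)) :=
  Quotient ((FinIrrModule.isoSetoid.{u, v, u} K (Onsager K)).comap
    (Subtype.val : OnsagerIrr.{u, v} K → FinIrrModule.{u, v, u} K (Onsager K)))

/-! Picture the vertices of a tetrahedron as four filtrations `F 0, …, F 3` of `V` and the edge `rs`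
as the map `X r s` acting as `2i - d` on `F r i ⊓ F s (d - i)`. The filtrations at vertices `0, 1`
are built from the eigenspaces of `A` in increasing and decreasing order of eigenvalue, those at `2,
3` from the eigenspaces of `B`. Indexing by `ℤ` lets steps below `0` and above `d` be handled
without case distinctions.

From `A, B` to the tetrahedron. By the Dolan-Grady relations each of `A, B` moves the filtrations of
the other by at most one step. Hence the sum over `i` of `F i ⊓ G (r - i)`, with `F` built from `A`
and `G` from `B`, is invariant under both maps, so it is `0` or `V`; comparing `r = d - 1` and `r =
d` gives oppositeness (`areOpposite_of_irreducible`), and sign changes of `A` and `B` cover the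
other mixed pairs. Opposite filtrations define the maps `X r s`. Their relations hold because a map
lowering one filtration and raising another sends each piece of the decomposition to a neighbouring
piece, where the eigenvalue is known (`bracket_of_shifts`, `dolanGrady_of_shifts`,
`isTetrahedronFamily_of_shifts`).

Uniqueness. In any module the triangle relations make `X r s` act on the graded pieces at vertex `r`
as `2i - d`, and likewise `-X r s` at vertex `s`. Such a map must be the split map of the two
filtrations (`isSplitMap_of_isAdapted`), and the filtrations depend only on `A` and `B`. The same
argument identifies the structure with the one given by the flags.

From an irreducible tetrahedron module back to `A, B`. The Dolan-Grady relation holds between any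
two edges, so the eigenspaces along a maximal string of eigenvalues with step `2` span an invariant
subspace, hence `V`; the triangle relations make the string symmetric and common to all edges. The
delicate point is that `X 0 1, X 2 3` already act irreducibly: a minimal subspace invariant under
both is the sum of its intersections with the pieces attached to every edge
(`le_antidiagonalSum_of_minimal`), so every edge preserves it. The bijection of classes follows from
these existence and uniqueness statements. -/

/-! ### Filtrations indexed by the integers -/

section Filtration

variable {K : Type u} {V : Type v} [Field K] [AddCommGroup V] [Module K V]

/-- An increasing family of subspaces which is `0` before `0` and everything from `d` on. -/
structure IsBoundedFiltration (d : ℕ) (F : ℤ → Submodule K V) : Prop where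
  mono : Monotone F
  eq_bot : ∀ i < 0, F i = ⊥
  eq_top : ∀ i, (d : ℤ) ≤ i → F i = ⊤

/-- `x` preserves `F` and acts on the `i`-th graded piece as the scalar `2i - d`. -/
def IsAdapted (d : ℕ) (x : Module.End K V) (F : ℤ → Submodule K V) : Prop :=
  ∀ (i : ℤ), ∀ v ∈ F i, x v - (2 * (i : K) - (d : K)) • v ∈ F (i - 1)

/-- `x` maps each step of `F` into the next one. -/
def Shifts (x : Module.End K V) (F : ℤ → Submodule K V) : Prop :=
  ∀ (i : ℤ), ∀ v ∈ F i, x v ∈ F (i + 1)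

/-- The filtrations `F` and `G` split each other in `d + 1` steps. -/
structure AreOpposite (d : ℕ) (F G : ℤ → Submodule K V) : Prop where
  disjoint : ∀ i j v, i + j < (d : ℤ) → v ∈ F i → v ∈ G j → v = 0
  span : ⨆ i : ℤ, F i ⊓ G (d - i) = ⊤

theorem AreOpposite.symm {d : ℕ} {F G : ℤ → Submodule K V} (h : AreOpposite d F G) :
    AreOpposite d G F := by
  refine ⟨fun i j v hij hi hj => h.disjoint j i v (by lia) hj hi, ?_⟩
  rw [eq_top_iff, ← h.span]
  refine iSup_le fun i => ?_
  refine le_trans ?_ (le_iSup _ ((d : ℤ) - i))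
  rw [sub_sub_cancel, inf_comm]

theorem IsAdapted.apply_mem {d : ℕ} {x : Module.End K V} {F : ℤ → Submodule K V}
    (hF : IsBoundedFiltration d F) (hx : IsAdapted d x F) {i : ℤ} {v : V} (hv : v ∈ F i) : x v ∈ F i := by
  have h := add_mem (hF.mono (by lia : i - 1 ≤ i) (hx i v hv))
    ((F i).smul_mem (2 * (i : K) - (d : K)) hv)
  rwa [sub_add_cancel] at h

theorem IsAdapted.neg_mem_sub {d : ℕ} {x : Module.End K V} {F : ℤ → Submodule K V}
    (hx : IsAdapted d (-x) F) {i : ℤ} {v : V} (hv : v ∈ F i) :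
    x v + (2 * (i : K) - (d : K)) • v ∈ F (i - 1) := by
  have h := neg_mem (hx i v hv)
  rw [LinearMap.neg_apply] at h
  convert h using 1
  module

theorem IsAdapted.shifts {d : ℕ} {x : Module.End K V} {F : ℤ → Submodule K V}
    (hF : IsBoundedFiltration d F) (hx : IsAdapted d x F) : Shifts x F :=
  fun i _ hv => hF.mono (by lia : i ≤ i + 1) (hx.apply_mem hF hv)

theorem Shifts.neg {x : Module.End K V} {F : ℤ → Submodule K V} (h : Shifts x F) :
    Shifts (-x) F := fun i v hv => neg_mem (h i v hv)

/-- `x` acts as `2i - d` on `F i ⊓ G (d - i)`. -/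
def IsSplitMap (d : ℕ) (F G : ℤ → Submodule K V) (x : Module.End K V) : Prop :=
  ∀ i : ℤ, ∀ v ∈ F i, v ∈ G (d - i) → x v = (2 * (i : K) - (d : K)) • v

theorem IsSplitMap.symm {d : ℕ} {F G : ℤ → Submodule K V} {x : Module.End K V}
    (h : IsSplitMap d F G x) : IsSplitMap d G F (-x) := by
  intro i v hi hj
  have := h (d - i) v hj (by rwa [sub_sub_cancel])
  rw [LinearMap.neg_apply, this]
  push_cast
  module

/-- The pieces with `k > i` all lie in `G (d - i - 1)`, which meets `F i` only in `0`, so a vector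
of `F i` has no component there. -/
theorem AreOpposite.le_iSup {d : ℕ} {F G : ℤ → Submodule K V} (h : AreOpposite d F G)
    (hF : IsBoundedFiltration d F) (hG : IsBoundedFiltration d G) (i : ℤ) :
    F i ≤ ⨆ k : ℤ, ⨆ _ : k ≤ i, F k ⊓ G (d - k) := by
  intro v hv
  have hle : (⊤ : Submodule K V) ≤
      (⨆ k : ℤ, ⨆ _ : k ≤ i, F k ⊓ G (d - k)) ⊔ G (d - i - 1) := by
    rw [← h.span]
    refine iSup_le fun k => ?_
    by_cases hk : k ≤ i
    · exact le_sup_of_le_left (le_iSup₂_of_le k hk le_rfl)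
    · exact le_sup_of_le_right (inf_le_right.trans (hG.mono (by lia)))
  have hL : (⨆ k : ℤ, ⨆ _ : k ≤ i, F k ⊓ G (d - k)) ≤ F i :=
    iSup₂_le fun k hk => inf_le_left.trans (hF.mono hk)
  obtain ⟨a, ha, b, hb, rfl⟩ := Submodule.mem_sup.1 (hle (Submodule.mem_top (x := v)))
  have hb' : b ∈ F i := by
    have := sub_mem hv (hL ha)
    rwa [add_sub_cancel_left] at this
  rw [h.disjoint i (d - i - 1) b (by lia) hb' hb, add_zero]
  exact ha

/-- The pieces span `V`. Identities between maps are checked piece by piece through this. -/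
theorem AreOpposite.ext {d : ℕ} {F G : ℤ → Submodule K V} (h : AreOpposite d F G)
    {x y : Module.End K V} (hxy : ∀ i : ℤ, ∀ v ∈ F i, v ∈ G (d - i) → x v = y v) : x = y := by
  have h1 : (⊤ : Submodule K V) ≤ LinearMap.eqLocus x y := by
    rw [← h.span]
    exact iSup_le fun i v hv => hxy i v hv.1 hv.2
  exact LinearMap.ext fun v => h1 (Submodule.mem_top (x := v))

theorem IsSplitMap.isAdapted {d : ℕ} {F G : ℤ → Submodule K V} {x : Module.End K V}
    (hx : IsSplitMap d F G x) (h : AreOpposite d F G)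
    (hF : IsBoundedFiltration d F) (hG : IsBoundedFiltration d G) : IsAdapted d x F := by
  intro i
  have h1 : F i ≤ (F (i - 1)).comap (x - (2 * (i : K) - (d : K)) • LinearMap.id) := by
    refine (h.le_iSup hF hG i).trans (iSup₂_le fun k hk v hv => ?_)
    rw [Submodule.mem_comap, LinearMap.sub_apply, hx k v hv.1 hv.2, LinearMap.smul_apply,
      LinearMap.id_apply, ← sub_smul]
    rcases hk.eq_or_lt with rfl | hk
    · simp
    · exact (F (i - 1)).smul_mem _ (hF.mono (by lia) hv.1)
  exact fun v hv => h1 hv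

/-- The pieces other than the `i`-th lie in `F (i - 1) ⊔ G (d - i - 1)`; oppositeness removes the
second component of a vector of the `i`-th piece, then the first. -/
theorem AreOpposite.iSupIndep {d : ℕ} {F G : ℤ → Submodule K V} (h : AreOpposite d F G)
    (hF : IsBoundedFiltration d F) (hG : IsBoundedFiltration d G) :
    iSupIndep fun i : ℤ => F i ⊓ G (d - i) := by
  intro i
  rw [Submodule.disjoint_def]
  intro v hv hv'
  have hle : (⨆ j : ℤ, ⨆ _ : j ≠ i, F j ⊓ G (d - j)) ≤ F (i - 1) ⊔ G (d - i - 1) := by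
    refine iSup₂_le fun j hj => ?_
    rcases lt_or_gt_of_ne hj with hj | hj
    · exact le_sup_of_le_left (inf_le_left.trans (hF.mono (by lia)))
    · exact le_sup_of_le_right (inf_le_right.trans (hG.mono (by lia)))
  obtain ⟨a, ha, b, hb, rfl⟩ := Submodule.mem_sup.1 (hle hv')
  have hb' : b ∈ F i := by
    have := sub_mem hv.1 (hF.mono (by lia : i - 1 ≤ i) ha)
    rwa [add_sub_cancel_left] at this
  rw [h.disjoint i (d - i - 1) b (by lia) hb' hb, add_zero] at hv ⊢
  exact h.disjoint (i - 1) (d - i) a (by lia) ha hv.2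

theorem AreOpposite.exists_isSplitMap {d : ℕ} {F G : ℤ → Submodule K V} (h : AreOpposite d F G)
    (hF : IsBoundedFiltration d F) (hG : IsBoundedFiltration d G) :
    ∃ x : Module.End K V, IsSplitMap d F G x := by
  set U : ℤ → Submodule K V := fun i => F i ⊓ G (d - i) with hU
  have hint : DirectSum.IsInternal U :=
    DirectSum.isInternal_submodule_of_iSupIndep_of_iSup_eq_top (h.iSupIndep hF hG) h.span
  let e := LinearEquiv.ofBijective (DirectSum.coeLinearMap U) hint
  let D : (DirectSum ℤ fun i => U i) →ₗ[K] V :=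
    DirectSum.toModule K ℤ V fun i => (2 * (i : K) - (d : K)) • (U i).subtype
  refine ⟨D ∘ₗ e.symm.toLinearMap, fun i v hi hj => ?_⟩
  have h1 : e.symm v = DirectSum.lof K ℤ (fun i => U i) i ⟨v, hi, hj⟩ := by
    rw [LinearEquiv.symm_apply_eq]
    exact (DirectSum.coeLinearMap_lof U i ⟨v, hi, hj⟩).symm
  rw [LinearMap.comp_apply, LinearEquiv.coe_coe, h1, DirectSum.toModule_lof]
  rfl

/-! ### Commutation relations between adapted maps -/

/-- If `x` shifts `H`, is adapted to `G` up to sign and `y` splits `G` and `H`, then `x` and `y`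
satisfy the relation between consecutive edges of the tetrahedron. -/
theorem bracket_of_shifts {d : ℕ} {G H : ℤ → Submodule K V} {x y : Module.End K V}
    (hH : IsBoundedFiltration d H) (h : AreOpposite d G H)
    (hxG : IsAdapted d (-x) G) (hxH : Shifts x H) (hy : IsSplitMap d G H y) :
    x * y - y * x = (2 : K) • x + (2 : K) • y := by
  refine h.ext fun i v hi hj => ?_
  have hyv := hy i v hi hj
  -- Since `y v = (2i - d) v`, this vector is `(x + y) v`. It is one step lower in `G` and at most
  -- one higher in `H`, so it lies in piece `i - 1`, where `y` acts as `2(i - 1) - d`; this is the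
  -- relation applied to `v`.
  have h1 : x v + (2 * (i : K) - (d : K)) • v ∈ G (i - 1) := hxG.neg_mem_sub hi
  have h2 : x v + (2 * (i : K) - (d : K)) • v ∈ H (d - (i - 1)) := by
    refine add_mem ?_ ((H _).smul_mem _ (hH.mono (by lia) hj))
    have := hxH _ v hj
    rwa [show (d : ℤ) - i + 1 = d - (i - 1) by ring] at this
  have h3 := hy _ _ h1 h2
  rw [map_add, map_smul, hyv] at h3
  simp only [LinearMap.sub_apply, Module.End.mul_apply, LinearMap.add_apply, LinearMap.smul_apply,
    hyv, map_smul]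
  push_cast at h3
  linear_combination (norm := module) -h3

/-- The Dolan-Grady relation between opposite edges. -/
theorem dolanGrady_of_shifts {d : ℕ} {F G : ℤ → Submodule K V} {x y : Module.End K V}
    (hF : IsBoundedFiltration d F) (hG : IsBoundedFiltration d G) (h : AreOpposite d F G)
    (hx : IsSplitMap d F G x) (hyF : Shifts y F) (hyG : Shifts y G) :
    ⁅x, ⁅x, ⁅x, y⁆⁆⁆ = (4 : K) • ⁅x, y⁆ := by
  have hxF : IsAdapted d x F := hx.isAdapted h hF hG
  have hxG : IsAdapted d (-x) G := hx.symm.isAdapted h.symm hG hF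
  refine h.ext fun i v hi hj => ?_
  have hv := hx i v hi hj
  set c : K := 2 * (i : K) - (d : K) with hc
  -- On `v`, where `x` acts as `c`, the relation reads `(x - (c - 2)) (x - c) (x - (c + 2)) y v =
  -- 0`. The first two factors bring `y v` from `F (i + 1)` down to `F (i - 1)` without leaving `G
  -- (d - i + 1)`, and on that piece `x` acts as `c - 2`.
  have a1 : x (y v) - (c + 2) • y v ∈ F i := by
    have := hxF _ _ (hyF i v hi)
    rw [add_sub_cancel_right] at this
    convert this using 2
    rw [hc]; push_cast; congr 1; ring
  have a2 := hxF i _ a1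
  have g1 : ∀ {u : V} (k : K) {j : ℤ}, u ∈ G j → x u - k • u ∈ G j := fun k _ hu =>
    sub_mem (by simpa using neg_mem (hxG.apply_mem hG hu)) ((G _).smul_mem _ hu)
  have a3 := g1 c (g1 (c + 2) (hyG _ v hj))
  have a4 := hx (i - 1) _ a2 (by rwa [show (d : ℤ) - (i - 1) = d - i + 1 by ring])
  simp only [map_sub, map_smul] at a4
  simp only [LieRing.of_associative_ring_bracket, LinearMap.sub_apply, Module.End.mul_apply,
    LinearMap.smul_apply, map_sub, hv, map_smul]
  push_cast at a4
  have hd : (d : K) = 2 * i - c := by rw [hc]; ring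
  rw [hd] at a4
  linear_combination (norm := module) a4

/-! ### Adapted maps in characteristic zero -/

variable [CharZero K]

/-- If `v` lies in `F k` with `k > i`, adaptedness puts `2(i - k) v` in `F (k - 1)`, and the scalar
is invertible; so `v` descends from `F d` to `F i`. -/
theorem IsAdapted.mem_of_apply_eq {d : ℕ} {x : Module.End K V} {F : ℤ → Submodule K V}
    (hF : IsBoundedFiltration d F) (hx : IsAdapted d x F) {i : ℤ} {v : V}
    (hv : x v = (2 * (i : K) - (d : K)) • v) : v ∈ F i := by
  have key : ∀ n : ℕ, ∀ k : ℤ, k ≤ i + n → v ∈ F k → v ∈ F i := by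
    intro n
    induction n with
    | zero => intro k hk h; exact hF.mono (by simpa using hk) h
    | succ n ih =>
      intro k hk h
      by_cases hki : k ≤ i
      · exact hF.mono hki h
      · refine ih (k - 1) (by push_cast at hk; lia) ?_
        have h1 := hx k v h
        rw [hv, ← sub_smul] at h1
        refine ((F (k - 1)).smul_mem_iff ?_).1 h1
        have h3 : ((i - k : ℤ) : K) ≠ 0 := by
          rw [Int.cast_ne_zero]; lia
        intro h2
        apply h3
        push_cast
        linear_combination h2 / 2
  refine key ((d : ℤ) - i).toNat d (by lia) ?_
  rw [hF.eq_top _ le_rfl]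
  trivial

/-- For `v` in both steps, `(x - (2i - d)) v` and `(x + (2j - d)) v` lie in intersections of smaller
total index and vanish by induction. Their difference is `2(i + j - d) v`, with a nonzero scalar as
`i + j < d`. The induction stops when `i + j < 0`, as one index is then negative. -/
theorem eq_zero_of_isAdapted {d : ℕ} {x : Module.End K V} {F G : ℤ → Submodule K V}
    (hF : IsBoundedFiltration d F) (hG : IsBoundedFiltration d G) (hxF : IsAdapted d x F)
    (hxG : IsAdapted d (-x) G) :
    ∀ i j v, i + j < (d : ℤ) → v ∈ F i → v ∈ G j → v = 0 := by
  have key : ∀ n : ℕ, ∀ i j v, i + j < (n : ℤ) → i + j < (d : ℤ) → v ∈ F i → v ∈ G j → v = 0 := by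
    intro n
    induction n with
    | zero =>
      intro i j v hn _ hi hj
      by_cases h : i < 0
      · rw [hF.eq_bot i h] at hi; exact hi
      · rw [hG.eq_bot j (by push_cast at hn; lia)] at hj; exact hj
    | succ n ih =>
      intro i j v hn hd hi hj
      push_cast at hn
      have h1 := ih (i - 1) j _ (by lia) (by lia) (hxF i v hi)
        (sub_mem ((neg_neg x ▸ (hxG.apply_mem hG hj |> neg_mem)) : x v ∈ G j)
          ((G j).smul_mem _ hj))
      have h2 := ih i (j - 1) _ (by lia) (by lia)
        (add_mem (hxF.apply_mem hF hi) ((F i).smul_mem _ hi)) (hxG.neg_mem_sub hj)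
      have h3 : ((i + j - d : ℤ) : K) • v = 0 := by
        have h4 : (2 : K) • (((i + j - d : ℤ) : K) • v) = 0 := by
          rw [← sub_zero (0 : V)]
          nth_rewrite 1 [← h2]
          rw [← h1]
          push_cast
          module
        exact (smul_eq_zero.1 h4).resolve_left two_ne_zero
      refine (smul_eq_zero.1 h3).resolve_left ?_
      exact Int.cast_ne_zero.2 (by lia)
  intro i j v hd
  exact key (d) i j v hd hd

/-- On the `i`-th piece the defect `(x - (2i - d)) v` drops one step in both filtrations at once, so
its total index is `d - 2` and it vanishes. This is the source of all the uniqueness statements. -/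
theorem isSplitMap_of_isAdapted {d : ℕ} {x : Module.End K V} {F G : ℤ → Submodule K V}
    (hF : IsBoundedFiltration d F) (hG : IsBoundedFiltration d G) (hxF : IsAdapted d x F)
    (hxG : IsAdapted d (-x) G) : IsSplitMap d F G x := by
  intro i v hi hj
  have h := hxG.neg_mem_sub hj
  refine sub_eq_zero.1
    (eq_zero_of_isAdapted hF hG hxF hxG (i - 1) (d - i - 1) _ (by lia) (hxF i v hi) ?_)
  convert h using 1
  push_cast
  module

/-- A map satisfying the relation between consecutive edges with `x` shifts the filtration
attached to `x`. -/
theorem shifts_of_bracket {d : ℕ} {F G : ℤ → Submodule K V} {x z : Module.End K V}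
    (hF : IsBoundedFiltration d F) (hG : IsBoundedFiltration d G) (h : AreOpposite d F G)
    (hx : IsSplitMap d F G x) (hz : z * x - x * z = (2 : K) • z + (2 : K) • x) :
    Shifts z G := by
  have hxG : IsAdapted d (-x) G := hx.symm.isAdapted h.symm hG hF
  intro j
  have h1 : G j ≤ (G (j + 1)).comap z := by
    refine (h.symm.le_iSup hG hF j).trans (iSup₂_le fun k hk v hv => ?_)
    have hv1 : x v = -((2 * (k : K) - (d : K)) • v) := by
      rw [← hx.symm k v hv.1 hv.2, LinearMap.neg_apply, neg_neg]
    have hzv := LinearMap.congr_fun hz v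
    simp only [LinearMap.sub_apply, Module.End.mul_apply, LinearMap.add_apply,
      LinearMap.smul_apply, hv1, map_neg, map_smul] at hzv
    -- The bracket relation makes `(z + x) v` an eigenvector of `-x` whose eigenvalue is larger by
    -- `2`.
    have h2 : z v + x v ∈ G (k + 1) := by
      refine hxG.mem_of_apply_eq hG ?_
      rw [LinearMap.neg_apply, map_add, hv1, map_neg, map_smul, hv1]
      push_cast
      linear_combination (norm := module) hzv
    have h3 : z v = (z v + x v) + (2 * (k : K) - (d : K)) • v := by rw [hv1]; abel
    rw [Submodule.mem_comap, h3]
    exact add_mem (hG.mono (by lia) h2) ((G _).smul_mem _ (hG.mono (by lia) hv.1))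
  exact fun v hv => h1 hv

/-- In a triangle with edges `x`, `y`, `z`, two of the three relations imply the third. -/
theorem bracket_of_bracket_of_bracket {d : ℕ} {F G H : ℤ → Submodule K V}
    {x y z : Module.End K V} (hF : IsBoundedFiltration d F)
    (hG : IsBoundedFiltration d G) (hH : IsBoundedFiltration d H)
    (hFG : AreOpposite d F G) (hGH : AreOpposite d G H)
    (hx : IsSplitMap d F G x) (hyG : IsAdapted d y G) (hyH : IsAdapted d (-y) H)
    (hzH : IsAdapted d z H)
    (hxy : x * y - y * x = (2 : K) • x + (2 : K) • y)
    (hzx : z * x - x * z = (2 : K) • z + (2 : K) • x) :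
    y * z - z * y = (2 : K) • y + (2 : K) • z := by
  have hxG : IsAdapted d (-x) G := hx.symm.isAdapted hFG.symm hG hF
  have hzG := shifts_of_bracket hF hG hFG hx hzx
  refine hGH.ext fun j v hi hj => ?_
  have e1 := LinearMap.congr_fun hxy v
  have e2 := LinearMap.congr_fun hzx v
  rw [← sub_eq_zero]
  -- The defect of the wanted relation, applied to a vector of `G j ⊓ H (d - j)`, stays in `G j` but
  -- drops a step in `H`. In `H` this holds because `-y` and `z` act by the same scalars on graded
  -- pieces, so both `y + z` and the commutator lower `H`.
  refine hGH.disjoint j (d - j - 1) _ (by lia) ?_ ?_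
  · have a1 : ∀ {i : ℤ} {u : V}, u ∈ G i → x u + y u ∈ G (i - 1) := by
      intro i u hu
      have := add_mem (hxG.neg_mem_sub hu) (hyG i u hu)
      convert this using 1
      abel
    have a2 : ∀ {i : ℤ} {u : V}, u ∈ G i → x u + z u ∈ G (i + 1) := fun hu =>
      add_mem (hG.mono (Int.le_add_one le_rfl) (by simpa using neg_mem (hxG.apply_mem hG hu)))
        (hzG _ _ hu)
    have b1 := a1 (a2 hi)
    rw [add_sub_cancel_right] at b1
    have b2 := a2 (a1 hi)
    rw [sub_add_cancel] at b2
    have b3 : x v ∈ G j := by simpa using neg_mem (hxG.apply_mem hG hi)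
    -- The two given relations yield `[y, z] - 2y - 2z = [x + y, x + z] + 4x`. Here `x + y` lowers
    -- `G` by one step and `x + z` raises it by at most one, so the commutator preserves `G`.
    have b4 := add_mem (sub_mem b1 b2) ((G j).smul_mem (4 : K) b3)
    convert b4 using 1
    simp only [LinearMap.sub_apply, Module.End.mul_apply, LinearMap.add_apply,
      LinearMap.smul_apply, map_add] at e1 e2 ⊢
    linear_combination (norm := module) e1 + e2
  · have a1 : y v + z v ∈ H (d - j - 1) := by
      have := add_mem (hyH.neg_mem_sub hj) (hzH _ v hj)
      convert this using 1
      abel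
    have a2 : ∀ {i : ℤ} {u : V}, u ∈ H i → y (z u) - z (y u) ∈ H (i - 1) := by
      intro i u hu
      have c1 := hzH i u hu
      have c2 := hyH.neg_mem_sub hu
      have c3 : y (z u - (2 * (i : K) - (d : K)) • u) ∈ H (i - 1) := by
        simpa using neg_mem (hyH.apply_mem hH c1)
      have c4 := hzH.apply_mem hH c2
      have c5 := add_mem (sub_mem c3 c4) ((H _).smul_mem (2 * (i : K) - (d : K)) (add_mem c1 c2))
      convert c5 using 1
      simp only [map_add, map_sub, map_smul]
      module
    have b := sub_mem (a2 hj) ((H _).smul_mem (2 : K) a1)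
    convert b using 1
    simp only [LinearMap.sub_apply, Module.End.mul_apply, LinearMap.add_apply,
      LinearMap.smul_apply]
    module

end Filtration

/-! ### The filtration by eigenspaces -/

section Eigenvalues

variable {K : Type u} {V : Type v} [Field K] [AddCommGroup V] [Module K V]

/-- The sum of the eigenspaces of `A` for the eigenvalues `2k - d` with `k ≤ i`. -/
def eigenFiltration (d : ℕ) (A : Module.End K V) (i : ℤ) : Submodule K V :=
  ⨆ k : ℤ, ⨆ _ : k ≤ i, A.eigenspace (2 * (k : K) - (d : K))

/-- `A` is diagonalizable with eigenvalues among the `2k - d`, `0 ≤ k ≤ d`. -/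
structure IsGraded (d : ℕ) (A : Module.End K V) : Prop where
  span : ⨆ k : ℤ, A.eigenspace (2 * (k : K) - (d : K)) = ⊤
  eq_bot : ∀ k : ℤ, k < 0 ∨ (d : ℤ) < k → A.eigenspace (2 * (k : K) - (d : K)) = ⊥

theorem eigenspace_neg_eq (A : Module.End K V) (μ : K) :
    (-A).eigenspace μ = A.eigenspace (-μ) := by
  ext v
  rw [Module.End.mem_eigenspace_iff, Module.End.mem_eigenspace_iff, LinearMap.neg_apply, neg_smul,
    neg_eq_iff_eq_neg]

theorem eigenspace_neg_sub (d : ℕ) (A : Module.End K V) (k : ℤ) :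
    (-A).eigenspace (2 * ((d - k : ℤ) : K) - (d : K)) = A.eigenspace (2 * (k : K) - (d : K)) := by
  rw [eigenspace_neg_eq]
  congr 1
  push_cast
  ring

theorem IsGraded.neg {d : ℕ} {A : Module.End K V} (h : IsGraded d A) : IsGraded d (-A) := by
  constructor
  · rw [eq_top_iff, ← h.span]
    refine iSup_le fun k => ?_
    rw [← eigenspace_neg_sub]
    exact le_iSup (fun k : ℤ => (-A).eigenspace (2 * (k : K) - (d : K))) ((d : ℤ) - k)
  · intro k hk
    have h1 := eigenspace_neg_sub d A (d - k)
    rw [sub_sub_cancel] at h1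
    rw [h1, h.eq_bot (d - k) (by lia)]

theorem eigenspace_le_eigenFiltration (d : ℕ) (A : Module.End K V) {k i : ℤ} (h : k ≤ i) :
    A.eigenspace (2 * (k : K) - (d : K)) ≤ eigenFiltration d A i :=
  le_iSup₂_of_le k h le_rfl

theorem IsGraded.isBoundedFiltration {d : ℕ} {A : Module.End K V} (h : IsGraded d A) :
    IsBoundedFiltration d (eigenFiltration d A) := by
  refine ⟨fun i j hij => iSup₂_le fun k hk => ?_, fun i hi => ?_, fun i hi => ?_⟩
  · exact eigenspace_le_eigenFiltration d A (hk.trans hij)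
  · rw [eq_bot_iff]
    exact iSup₂_le fun k hk => (h.eq_bot k (Or.inl (by lia))).le
  · rw [eq_top_iff, ← h.span]
    refine iSup_le fun k => ?_
    by_cases hk : k ≤ i
    · exact eigenspace_le_eigenFiltration d A hk
    · rw [h.eq_bot k (Or.inr (by lia))]
      exact bot_le

theorem isAdapted_eigenFiltration (d : ℕ) (A : Module.End K V) :
    IsAdapted d A (eigenFiltration d A) := by
  intro i
  have h1 : eigenFiltration d A i ≤
      (eigenFiltration d A (i - 1)).comap (A - (2 * (i : K) - (d : K)) • LinearMap.id) := by
    refine iSup₂_le fun k hk v hv => ?_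
    rw [Submodule.mem_comap, LinearMap.sub_apply, Module.End.mem_eigenspace_iff.1 hv,
      LinearMap.smul_apply, LinearMap.id_apply, ← sub_smul]
    rcases hk.eq_or_lt with rfl | hk
    · simp
    · exact Submodule.smul_mem _ _ (eigenspace_le_eigenFiltration d A (by lia) hv)
  exact fun v hv => h1 hv

theorem IsGraded.exists_of_hasEigenvalue {d : ℕ} {A : Module.End K V} (h : IsGraded d A) {μ : K}
    (hμ : A.HasEigenvalue μ) : ∃ k : ℕ, k ≤ d ∧ μ = 2 * (k : K) - (d : K) := by
  have h1 : ∃ k : ℤ, μ = 2 * (k : K) - (d : K) := by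
    by_contra! hne
    refine hμ (disjoint_self.1 ((A.eigenspaces_iSupIndep μ).mono_right ?_))
    refine le_trans le_top (h.span ▸ iSup_le fun k => ?_)
    exact le_iSup₂_of_le (2 * (k : K) - (d : K)) (hne k).symm le_rfl
  obtain ⟨k, rfl⟩ := h1
  have hk : ¬(k < 0 ∨ (d : ℤ) < k) := fun hk => hμ (h.eq_bot k hk)
  lift k to ℕ using by lia
  exact ⟨k, by lia, by simp⟩

/-- A map in the relation between consecutive edges with `x` is adapted to the filtration
of `-x`. -/
theorem isAdapted_of_bracket (d : ℕ) {x y : Module.End K V}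
    (h : x * y - y * x = (2 : K) • x + (2 : K) • y) :
    IsAdapted d y (eigenFiltration d (-x)) := by
  intro i
  have h1 : eigenFiltration d (-x) i ≤
      (eigenFiltration d (-x) (i - 1)).comap (y - (2 * (i : K) - (d : K)) • LinearMap.id) := by
    refine iSup₂_le fun k hk v hv => ?_
    have hv' := Module.End.mem_eigenspace_iff.1 hv
    have hv1 : x v = -((2 * (k : K) - (d : K)) • v) := by
      rw [← hv', LinearMap.neg_apply, neg_neg]
    have hh := LinearMap.congr_fun h v
    simp only [LinearMap.sub_apply, Module.End.mul_apply, LinearMap.add_apply,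
      LinearMap.smul_apply, hv1, map_neg, map_smul] at hh
    -- The bracket relation makes `(x + y) v` an eigenvector of `-x` whose eigenvalue is smaller by
    -- `2`.
    have h2 : x v + y v ∈ eigenFiltration d (-x) (i - 1) := by
      refine eigenspace_le_eigenFiltration d (-x) (by lia : k - 1 ≤ i - 1)
        (Module.End.mem_eigenspace_iff.2 ?_)
      rw [LinearMap.neg_apply, map_add, hv1, map_neg, map_smul, hv1]
      push_cast
      linear_combination (norm := module) -hh
    rw [Submodule.mem_comap, LinearMap.sub_apply, LinearMap.smul_apply, LinearMap.id_apply]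
    have h3 : y v - (2 * (i : K) - (d : K)) • v =
        (x v + y v) + (2 * (k : K) - 2 * (i : K)) • v := by rw [hv1]; module
    rw [h3]
    refine add_mem h2 ?_
    rcases hk.eq_or_lt with rfl | hk
    · simp
    · exact Submodule.smul_mem _ _ (eigenspace_le_eigenFiltration d (-x) (by lia) hv)
  exact fun v hv => h1 hv

variable [CharZero K]

/-- Filtrations to which `x` and `-x` are adapted are opposite if `x` is diagonalizable. -/
theorem IsGraded.areOpposite {d : ℕ} {x : Module.End K V} {F G : ℤ → Submodule K V}
    (h : IsGraded d x) (hF : IsBoundedFiltration d F) (hG : IsBoundedFiltration d G)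
    (hxF : IsAdapted d x F) (hxG : IsAdapted d (-x) G) : AreOpposite d F G := by
  refine ⟨eq_zero_of_isAdapted hF hG hxF hxG, ?_⟩
  rw [eq_top_iff, ← h.span]
  refine iSup_le fun k => ?_
  refine le_trans (fun v hv => ?_) (le_iSup _ k)
  refine ⟨hxF.mem_of_apply_eq hF (Module.End.mem_eigenspace_iff.1 hv),
    hxG.mem_of_apply_eq hG (Module.End.mem_eigenspace_iff.1 ?_)⟩
  rwa [eigenspace_neg_sub]

theorem IsGraded.areOpposite_neg {d : ℕ} {A : Module.End K V} (h : IsGraded d A) :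
    AreOpposite d (eigenFiltration d A) (eigenFiltration d (-A)) :=
  h.areOpposite h.isBoundedFiltration h.neg.isBoundedFiltration (isAdapted_eigenFiltration d A)
    (isAdapted_eigenFiltration d (-A))

/-- If `ad A` is annihilated on `B` by `t³ - 4t`, then `B` changes eigenvalues of `A` by `0` or
`± 2`. -/
theorem apply_mem_of_dolanGrady {A B : Module.End K V} (h : ⁅A, ⁅A, ⁅A, B⁆⁆⁆ = (4 : K) • ⁅A, B⁆)
    {μ : K} {v : V} (hv : v ∈ A.eigenspace μ) :
    B v ∈ A.eigenspace (μ - 2) ⊔ A.eigenspace μ ⊔ A.eigenspace (μ + 2) := by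
  rw [Module.End.mem_eigenspace_iff] at hv
  have hh := LinearMap.congr_fun h v
  simp only [LieRing.of_associative_ring_bracket, LinearMap.sub_apply, Module.End.mul_apply,
    LinearMap.smul_apply, map_sub, hv, map_smul] at hh
  set w := B v
  have h1 : w = (8⁻¹ : K) • (A (A w) - (2 * μ + 2) • A w + (μ * (μ + 2)) • w) +
      (4⁻¹ : K) • ((4 : K) • w - (A (A w) - (2 * μ) • A w + (μ * μ) • w)) +
      (8⁻¹ : K) • (A (A w) - (2 * μ - 2) • A w + (μ * (μ - 2)) • w) := by
    match_scalars <;> field_simp <;> ring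
  rw [h1]
  refine Submodule.add_mem_sup (Submodule.add_mem_sup ?_ ?_) ?_
  all_goals
    refine Submodule.smul_mem _ _ (Module.End.mem_eigenspace_iff.2 ?_)
    simp only [map_add, map_sub, map_smul]
  · linear_combination (norm := module) hh
  · linear_combination (norm := module) -hh
  · linear_combination (norm := module) hh

theorem shifts_of_dolanGrady (d : ℕ) {A B : Module.End K V}
    (h : ⁅A, ⁅A, ⁅A, B⁆⁆⁆ = (4 : K) • ⁅A, B⁆) : Shifts B (eigenFiltration d A) := by
  intro i
  have h1 : eigenFiltration d A i ≤ (eigenFiltration d A (i + 1)).comap B := by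
    refine iSup₂_le fun k hk v hv => ?_
    have h2 := apply_mem_of_dolanGrady h hv
    refine (sup_le (sup_le ?_ ?_) ?_ :
      _ ≤ eigenFiltration d A (i + 1)) h2
    · convert eigenspace_le_eigenFiltration d A (by lia : k - 1 ≤ i + 1) using 2
      push_cast; ring
    · exact eigenspace_le_eigenFiltration d A (by lia)
    · convert eigenspace_le_eigenFiltration d A (by lia : k + 1 ≤ i + 1) using 2
      push_cast; ring
  exact fun v hv => h1 hv

end Eigenvalues

/-! ### The split decompositions -/

section Split

variable {K : Type u} {V : Type v} [Field K] [AddCommGroup V] [Module K V]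

/-- The sum of the intersections of the steps of `F` and `G` of complementary index. -/
def antidiagonalSum (F G : ℤ → Submodule K V) (r : ℤ) : Submodule K V :=
  ⨆ i : ℤ, F i ⊓ G (r - i)

theorem antidiagonalSum_comm (F G : ℤ → Submodule K V) (r : ℤ) :
    antidiagonalSum F G r = antidiagonalSum G F r := by
  refine le_antisymm ?_ ?_ <;>
  · refine iSup_le fun i => ?_
    refine le_trans ?_ (le_iSup _ (r - i))
    rw [sub_sub_cancel, inf_comm]

/-- Up to a scalar, `A` lowers the index in `F` by one and raises the index in `G` by at most one,
so the total `r` does not grow. -/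
theorem antidiagonalSum_le_comap {d : ℕ} {F G : ℤ → Submodule K V} {A : Module.End K V}
    (hGm : Monotone G)
    (hF : IsAdapted d A F) (hG : Shifts A G) (r : ℤ) :
    antidiagonalSum F G r ≤ (antidiagonalSum F G r).comap A := by
  refine iSup_le fun i v hv => ?_
  have h1 : A v - (2 * (i : K) - (d : K)) • v ∈ antidiagonalSum F G r := by
    refine le_iSup (fun i => F i ⊓ G (r - i)) (i - 1) ⟨hF i v hv.1, ?_⟩
    rw [show r - (i - 1) = r - i + 1 by ring]
    have h2 := hG _ v hv.2
    exact sub_mem h2 (Submodule.smul_mem _ _ (hGm (by lia) hv.2))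
  have h2 : v ∈ antidiagonalSum F G r := le_iSup (fun i => F i ⊓ G (r - i)) i hv
  rw [Submodule.mem_comap]
  simpa using add_mem h1 (Submodule.smul_mem _ (2 * (i : K) - (d : K)) h2)

/-- For an irreducible pair `A, B`, a filtration adapted to `A` and shifted by `B` and a filtration
adapted to `B` and shifted by `A` are opposite. -/
theorem areOpposite_of_irreducible {d : ℕ} {F G : ℤ → Submodule K V} {A B : Module.End K V}
    (hF : IsBoundedFiltration d F) (hG : IsBoundedFiltration d G)
    (hAF : IsAdapted d A F) (hBF : Shifts B F) (hBG : IsAdapted d B G) (hAG : Shifts A G)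
    (hirr : ∀ W : Submodule K V, W ≤ W.comap A → W ≤ W.comap B → W = ⊥ ∨ W = ⊤)
    (hFd : F (d - 1) ≠ ⊤) (hG0 : G 0 ≠ ⊥) : AreOpposite d F G := by
  have hZ : ∀ r, antidiagonalSum F G r = ⊥ ∨ antidiagonalSum F G r = ⊤ := fun r =>
    hirr _ (antidiagonalSum_le_comap hG.mono hAF hAG r) (by
      rw [antidiagonalSum_comm]
      exact antidiagonalSum_le_comap hF.mono hBG hBF r)
  constructor
  · have h1 : antidiagonalSum F G (d - 1) = ⊥ := by
      refine (hZ _).resolve_right fun h => hFd ?_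
      rw [eq_top_iff, ← h]
      refine iSup_le fun i => ?_
      by_cases hi : i ≤ d - 1
      · exact inf_le_left.trans (hF.mono hi)
      · rw [hG.eq_bot _ (by lia), inf_bot_eq]
        exact bot_le
    intro i j v hij hi hj
    have h2 : v ∈ antidiagonalSum F G (d - 1) :=
      le_iSup (fun i => F i ⊓ G ((d - 1 : ℤ) - i)) i ⟨hi, hG.mono (by lia) hj⟩
    rw [h1] at h2
    exact h2
  · refine (hZ d).resolve_left fun h => hG0 ?_
    rw [eq_bot_iff, ← h]
    refine le_trans ?_ (le_iSup _ (d : ℤ))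
    rw [hF.eq_top _ le_rfl, sub_self, top_inf_eq]

end Split

/-! ### Onsager pairs and the four filtrations -/

section OnsagerPair

variable {K : Type u} {V : Type v} [Field K] [AddCommGroup V] [Module K V]

/-- The pair of maps by which the generators act on an irreducible module of type `(0,0)` and
diameter `d` of the Onsager algebra. -/
structure IsOnsagerPair (d : ℕ) (A B : Module.End K V) : Prop where
  left : IsGraded d A
  right : IsGraded d B
  left_ne_bot : ∀ k : ℤ, 0 ≤ k → k ≤ d → A.eigenspace (2 * (k : K) - (d : K)) ≠ ⊥
  right_ne_bot : ∀ k : ℤ, 0 ≤ k → k ≤ d → B.eigenspace (2 * (k : K) - (d : K)) ≠ ⊥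
  dolanGrady_left : ⁅A, ⁅A, ⁅A, B⁆⁆⁆ = (4 : K) • ⁅A, B⁆
  dolanGrady_right : ⁅B, ⁅B, ⁅B, A⁆⁆⁆ = (4 : K) • ⁅B, A⁆
  irreducible : ∀ W : Submodule K V, W ≤ W.comap A → W ≤ W.comap B → W = ⊥ ∨ W = ⊤

theorem IsOnsagerPair.swap {d : ℕ} {A B : Module.End K V} (h : IsOnsagerPair d A B) :
    IsOnsagerPair d B A :=
  ⟨h.right, h.left, h.right_ne_bot, h.left_ne_bot, h.dolanGrady_right, h.dolanGrady_left,
    fun W hB hA => h.irreducible W hA hB⟩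

theorem IsOnsagerPair.neg_left {d : ℕ} {A B : Module.End K V} (h : IsOnsagerPair d A B) :
    IsOnsagerPair d (-A) B := by
  refine ⟨h.left.neg, h.right, fun k h0 hd => ?_, h.right_ne_bot, ?_, ?_, fun W hA hB =>
    h.irreducible W (fun v hv => ?_) hB⟩
  · have h1 := eigenspace_neg_sub d A (d - k)
    rw [sub_sub_cancel] at h1
    rw [h1]
    exact h.left_ne_bot _ (by lia) (by lia)
  · have h1 := h.dolanGrady_left
    simp only [LieRing.of_associative_ring_bracket, neg_mul, mul_neg, mul_sub, sub_mul,
      smul_sub] at h1 ⊢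
    linear_combination (norm := module) -h1
  · have h1 := h.dolanGrady_right
    simp only [LieRing.of_associative_ring_bracket, neg_mul, mul_neg, mul_sub, sub_mul,
      smul_sub] at h1 ⊢
    linear_combination (norm := module) -h1
  · simpa using neg_mem (hA hv)

theorem IsOnsagerPair.neg_right {d : ℕ} {A B : Module.End K V} (h : IsOnsagerPair d A B) :
    IsOnsagerPair d A (-B) :=
  h.swap.neg_left.swap

/-- The vertex joined to `r` by one of the edges `01` and `23`. -/
def partner (r : Fin 4) : Fin 4 := ![1, 0, 3, 2] r

theorem ne_partner : ∀ r : Fin 4, r ≠ partner r := by decide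

/-- The four filtrations attached to a pair of maps. -/
def edgeFiltration (d : ℕ) (A B : Module.End K V) (r : Fin 4) : ℤ → Submodule K V :=
  eigenFiltration d (![A, -A, B, -B] r)

theorem IsOnsagerPair.isBoundedFiltration {d : ℕ} {A B : Module.End K V}
    (h : IsOnsagerPair d A B) (r : Fin 4) : IsBoundedFiltration d (edgeFiltration d A B r) := by
  fin_cases r
  exacts [h.left.isBoundedFiltration, h.left.neg.isBoundedFiltration, h.right.isBoundedFiltration,
    h.right.neg.isBoundedFiltration]

/-! ### Families satisfying the tetrahedron relations -/

/-- Maps `X r s` satisfying the defining relations of the tetrahedron algebra. -/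
structure IsTetrahedronFamily (X : Fin 4 → Fin 4 → Module.End K V) : Prop where
  skew : ∀ r s, r ≠ s → X s r = -X r s
  triangle : ∀ r s t, r ≠ s → s ≠ t → r ≠ t →
    X r s * X s t - X s t * X r s = (2 : K) • X r s + (2 : K) • X s t
  dolanGrady : ∀ r s t u, r ≠ s → r ≠ t → r ≠ u → s ≠ t → s ≠ u → t ≠ u →
    ⁅X r s, ⁅X r s, ⁅X r s, X t u⁆⁆⁆ = (4 : K) • ⁅X r s, X t u⁆

/-- A filtration built from an edge at `r` serves every edge at `r`: when `p ≠ s`, the edges `pr`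
and `rs` are consecutive and `X r p = -X p r`. -/
theorem IsTetrahedronFamily.isAdapted {X : Fin 4 → Fin 4 → Module.End K V}
    (h : IsTetrahedronFamily X) (d : ℕ) {r s p : Fin 4} (hrs : r ≠ s) (hrp : r ≠ p) :
    IsAdapted d (X r s) (eigenFiltration d (X r p)) := by
  by_cases hsp : p = s
  · subst hsp
    exact isAdapted_eigenFiltration d _
  · rw [h.skew p r hrp.symm]
    exact isAdapted_of_bracket d (h.triangle p r s hrp.symm hrs hsp)

theorem IsTetrahedronFamily.isAdapted_neg {X : Fin 4 → Fin 4 → Module.End K V}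
    (h : IsTetrahedronFamily X) (d : ℕ) {r s p : Fin 4} (hrs : r ≠ s) (hsp : s ≠ p) :
    IsAdapted d (-X r s) (eigenFiltration d (X s p)) := by
  rw [← h.skew r s hrs]
  exact h.isAdapted d hrs.symm hsp

theorem IsTetrahedronFamily.eq_eigenFiltration {X : Fin 4 → Fin 4 → Module.End K V}
    (h : IsTetrahedronFamily X) (d : ℕ) (r : Fin 4) :
    edgeFiltration d (X 0 1) (X 2 3) r = eigenFiltration d (X r (partner r)) := by
  have h1 : ![X 0 1, -X 0 1, X 2 3, -X 2 3] r = X r (partner r) := by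
    fin_cases r
    exacts [rfl, (h.skew 0 1 (by decide)).symm, rfl, (h.skew 2 3 (by decide)).symm]
  rw [edgeFiltration, h1]

theorem IsTetrahedronFamily.isAdapted_edgeFiltration {X : Fin 4 → Fin 4 → Module.End K V}
    (h : IsTetrahedronFamily X) (d : ℕ) {r s : Fin 4} (hrs : r ≠ s) :
    IsAdapted d (X r s) (edgeFiltration d (X 0 1) (X 2 3) r) ∧
      IsAdapted d (-X r s) (edgeFiltration d (X 0 1) (X 2 3) s) := by
  rw [h.eq_eigenFiltration, h.eq_eigenFiltration]
  exact ⟨h.isAdapted d hrs (ne_partner r), h.isAdapted_neg d hrs (ne_partner s)⟩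

variable [CharZero K]

/-- The eigenspace for `2i - d` also lies in step `d - i` of the filtration of `-A`, which meets
step `i - 1` of that of `A` trivially. -/
theorem eigenFiltration_lt_of_ne_bot {d : ℕ} {A : Module.End K V} (hA : IsGraded d A) {i : ℤ}
    (h : A.eigenspace (2 * (i : K) - (d : K)) ≠ ⊥) :
    eigenFiltration d A (i - 1) < eigenFiltration d A i := by
  refine lt_of_le_of_ne (hA.isBoundedFiltration.mono (by lia)) fun heq => h ?_
  rw [Submodule.eq_bot_iff]
  intro v hv
  refine hA.areOpposite_neg.disjoint (i - 1) (d - i) v (by lia) ?_ ?_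
  · rw [heq]
    exact eigenspace_le_eigenFiltration d A le_rfl hv
  · rw [← eigenspace_neg_sub] at hv
    exact eigenspace_le_eigenFiltration d (-A) le_rfl hv

theorem IsOnsagerPair.areOpposite {d : ℕ} {A B : Module.End K V} (h : IsOnsagerPair d A B) :
    AreOpposite d (eigenFiltration d A) (eigenFiltration d B) := by
  refine areOpposite_of_irreducible h.left.isBoundedFiltration h.right.isBoundedFiltration
    (isAdapted_eigenFiltration d A) (shifts_of_dolanGrady d h.dolanGrady_left)
    (isAdapted_eigenFiltration d B) (shifts_of_dolanGrady d h.dolanGrady_right) h.irreducible ?_ ?_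
  · have h1 := eigenFiltration_lt_of_ne_bot h.left (h.left_ne_bot d (by lia) le_rfl)
    exact (h1.trans_le le_top).ne
  · have h1 := eigenFiltration_lt_of_ne_bot h.right (h.right_ne_bot 0 le_rfl (by lia))
    exact (bot_le.trans_lt h1).ne'

/-- The pairs `01` and `23` are opposite by diagonalizability; the four mixed pairs reduce to
`areOpposite`, as the conditions on `A, B` survive changes of sign. -/
theorem IsOnsagerPair.areOpposite_edgeFiltration {d : ℕ} {A B : Module.End K V}
    (h : IsOnsagerPair d A B) {r s : Fin 4} (hrs : r ≠ s) :
    AreOpposite d (edgeFiltration d A B r) (edgeFiltration d A B s) := by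
  have key : ∀ r s : Fin 4, r < s →
      AreOpposite d (edgeFiltration d A B r) (edgeFiltration d A B s) := by
    intro r s hrs
    fin_cases r <;> fin_cases s <;> first | exact absurd hrs (by decide) | skip
    exacts [h.left.areOpposite_neg, h.areOpposite, h.neg_right.areOpposite,
      h.neg_left.areOpposite, h.neg_left.neg_right.areOpposite, h.right.areOpposite_neg]
  rcases lt_or_gt_of_ne hrs with hlt | hlt
  exacts [key r s hlt, (key s r hlt).symm]

/-- The split maps of four mutually opposite filtrations satisfy the tetrahedron relations as soon
as those on one pair of opposite edges shift the remaining filtrations. -/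
theorem isTetrahedronFamily_of_shifts {d : ℕ} {F : Fin 4 → ℤ → Submodule K V}
    {X : Fin 4 → Fin 4 → Module.End K V} (hF : ∀ r, IsBoundedFiltration d (F r))
    (hopp : ∀ r s, r ≠ s → AreOpposite d (F r) (F s))
    (hX : ∀ r s, r ≠ s → IsSplitMap d (F r) (F s) (X r s))
    (h01 : ∀ t, Shifts (X 0 1) (F t)) (h23 : ∀ t, Shifts (X 2 3) (F t)) :
    IsTetrahedronFamily X := by
  have skew : ∀ r s, r ≠ s → X s r = -X r s := by
    intro r s hrs
    refine (hopp s r hrs.symm).ext fun i v hi hj => ?_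
    rw [hX s r hrs.symm i v hi hj, (hX r s hrs).symm i v hi hj]
  have adapt : ∀ r s, r ≠ s → IsAdapted d (X r s) (F r) := fun r s hrs =>
    (hX r s hrs).isAdapted (hopp r s hrs) (hF r) (hF s)
  have adapt' : ∀ r s, r ≠ s → IsAdapted d (-X r s) (F s) := fun r s hrs => by
    rw [← skew r s hrs]
    exact adapt s r hrs.symm
  -- An edge that shifts all four filtrations satisfies the triangle relation with each edge
  -- following it; reversing the path gives the version for edges preceding it.
  have tri1 : ∀ r s t, r ≠ s → s ≠ t → (∀ t, Shifts (X r s) (F t)) →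
      X r s * X s t - X s t * X r s = (2 : K) • X r s + (2 : K) • X s t :=
    fun r s t hrs hst h =>
      bracket_of_shifts (hF t) (hopp s t hst) (adapt' r s hrs) (h t) (hX s t hst)
  have tri2 : ∀ r s t, r ≠ s → s ≠ t → (∀ u, Shifts (X t s) (F u)) →
      X r s * X s t - X s t * X r s = (2 : K) • X r s + (2 : K) • X s t := by
    intro r s t hrs hst h
    have h1 := tri1 t s r hst.symm hrs.symm h
    rw [skew r s hrs, skew s t hst] at h1
    simp only [neg_mul_neg] at h1
    linear_combination (norm := module) -h1
  have hH : ∀ r t, Shifts (X r (partner r)) (F t) := by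
    intro r t
    fin_cases r
    · exact h01 t
    · exact skew 0 1 (by decide) ▸ (h01 t).neg
    · exact h23 t
    · exact skew 2 3 (by decide) ▸ (h23 t).neg
  -- Any three vertices include both ends of `01` or of `23`. If that edge is on the path `r, s, t`,
  -- the relation is already known; if it closes the triangle, the two relations involving it imply
  -- the third.
  have cases3 : ∀ r s t : Fin 4, r ≠ s → s ≠ t → r ≠ t →
      s = partner r ∨ s = partner t ∨ r = partner t := by decide
  have tri : ∀ r s t, r ≠ s → s ≠ t → r ≠ t →
      X r s * X s t - X s t * X r s = (2 : K) • X r s + (2 : K) • X s t := by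
    intro r s t hrs hst hrt
    rcases cases3 r s t hrs hst hrt with h | h | h
    · exact tri1 r s t hrs hst (h ▸ hH r)
    · exact tri2 r s t hrs hst (h ▸ hH t)
    · have h1 : ∀ u, Shifts (X t r) (F u) := h ▸ hH t
      refine bracket_of_bracket_of_bracket (hF t) (hF r) (hF s) (hopp t r hrt.symm)
        (hopp r s hrs) (hX t r hrt.symm) (adapt r s hrs) (adapt' r s hrs) (adapt s t hst)
        (tri1 t r s hrt.symm hrs h1) (tri2 s t r hst hrt.symm fun u => ?_)
      rw [skew t r hrt.symm]
      exact (h1 u).neg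
  -- The triangle relations now show that `X t u` shifts the filtrations at the other two vertices,
  -- the hypothesis needed for Dolan-Grady.
  have shift : ∀ t u r, t ≠ u → u ≠ r → t ≠ r → Shifts (X t u) (F r) := fun t u r htu hur htr =>
    shifts_of_bracket (hF u) (hF r) (hopp u r hur) (hX u r hur) (tri t u r htu hur htr)
  exact ⟨skew, tri, fun r s t u hrs hrt hru hst hsu htu =>
    dolanGrady_of_shifts (hF r) (hF s) (hopp r s hrs) (hX r s hrs)
      (shift t u r htu hru.symm hrt.symm) (shift t u s htu hsu.symm hst.symm)⟩

/-- The filtrations here involve only `X 0 1` and `X 2 3`, so these two edges determine all the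
others. -/
theorem IsOnsagerPair.isSplitMap {d : ℕ} {X : Fin 4 → Fin 4 → Module.End K V}
    (hX : IsTetrahedronFamily X) (h : IsOnsagerPair d (X 0 1) (X 2 3)) {r s : Fin 4} (hrs : r ≠ s) :
    IsSplitMap d (edgeFiltration d (X 0 1) (X 2 3) r) (edgeFiltration d (X 0 1) (X 2 3) s)
      (X r s) :=
  isSplitMap_of_isAdapted (h.isBoundedFiltration r) (h.isBoundedFiltration s)
    (hX.isAdapted_edgeFiltration d hrs).1 (hX.isAdapted_edgeFiltration d hrs).2

theorem IsOnsagerPair.exists_isTetrahedronFamily {d : ℕ} {A B : Module.End K V}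
    (h : IsOnsagerPair d A B) :
    ∃ X : Fin 4 → Fin 4 → Module.End K V, IsTetrahedronFamily X ∧ X 0 1 = A ∧ X 2 3 = B := by
  have hex : ∀ r s : Fin 4, ∃ x : Module.End K V, r ≠ s →
      IsSplitMap d (edgeFiltration d A B r) (edgeFiltration d A B s) x := by
    intro r s
    by_cases hrs : r = s
    · exact ⟨0, fun h => absurd hrs h⟩
    · obtain ⟨x, hx⟩ := (h.areOpposite_edgeFiltration hrs).exists_isSplitMap
        (h.isBoundedFiltration r) (h.isBoundedFiltration s)
      exact ⟨x, fun _ => hx⟩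
  choose X hX using hex
  -- `A` is adapted to its own filtration and `-A` to its own, so `A` is itself the split map for
  -- vertices `0, 1`.
  have hA : X 0 1 = A := by
    refine (h.areOpposite_edgeFiltration (by decide : (0 : Fin 4) ≠ 1)).ext fun i v hi hj => ?_
    rw [hX 0 1 (by decide) i v hi hj]
    exact (isSplitMap_of_isAdapted (h.isBoundedFiltration 0) (h.isBoundedFiltration 1)
      (isAdapted_eigenFiltration d A) (isAdapted_eigenFiltration d (-A)) i v hi hj).symm
  have hB : X 2 3 = B := by
    refine (h.areOpposite_edgeFiltration (by decide : (2 : Fin 4) ≠ 3)).ext fun i v hi hj => ?_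
    rw [hX 2 3 (by decide) i v hi hj]
    exact (isSplitMap_of_isAdapted (h.isBoundedFiltration 2) (h.isBoundedFiltration 3)
      (isAdapted_eigenFiltration d B) (isAdapted_eigenFiltration d (-B)) i v hi hj).symm
  refine ⟨X, isTetrahedronFamily_of_shifts h.isBoundedFiltration
    (fun r s => h.areOpposite_edgeFiltration) hX ?_ ?_, hA, hB⟩
  · rw [hA]
    intro t
    fin_cases t
    · exact (isAdapted_eigenFiltration d A).shifts (h.isBoundedFiltration 0)
    · simpa using ((isAdapted_eigenFiltration d (-A)).shifts (h.isBoundedFiltration 1)).neg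
    · exact shifts_of_dolanGrady d h.dolanGrady_right
    · exact shifts_of_dolanGrady d h.neg_right.dolanGrady_right
  · rw [hB]
    intro t
    fin_cases t
    · exact shifts_of_dolanGrady d h.dolanGrady_left
    · exact shifts_of_dolanGrady d h.neg_left.dolanGrady_left
    · exact (isAdapted_eigenFiltration d B).shifts (h.isBoundedFiltration 2)
    · simpa using ((isAdapted_eigenFiltration d (-B)).shifts (h.isBoundedFiltration 3)).neg

theorem IsOnsagerPair.eq_of_isTetrahedronFamily {d : ℕ} {X Y : Fin 4 → Fin 4 → Module.End K V}
    (h : IsOnsagerPair d (X 0 1) (X 2 3)) (hX : IsTetrahedronFamily X) (hY : IsTetrahedronFamily Y)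
    (h01 : Y 0 1 = X 0 1) (h23 : Y 2 3 = X 2 3) {r s : Fin 4} (hrs : r ≠ s) : X r s = Y r s := by
  have hY' := IsOnsagerPair.isSplitMap (d := d) hY (by rwa [h01, h23]) hrs
  rw [h01, h23] at hY'
  refine (h.areOpposite_edgeFiltration hrs).ext fun i v hi hj => ?_
  rw [h.isSplitMap hX hrs i v hi hj, hY' i v hi hj]

end OnsagerPair

/-! ### Flags and decompositions -/

section Flags

variable {K : Type u} {V : Type v} [Field K] [AddCommGroup V] [Module K V]

/-- The flag consisting of the steps `0, …, d` of a filtration. -/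
def filtrationFlag (d : ℕ) (F : ℤ → Submodule K V) : Fin (d + 1) → Submodule K V :=
  fun i => F ((i : ℕ) : ℤ)

theorem iSup_le_eq_inducedFlag {d : ℕ} {E : ℤ → Submodule K V} {U : Fin (d + 1) → Submodule K V}
    (hE : ∀ k < 0, E k = ⊥) (hU : ∀ j : Fin (d + 1), U j = E ((j : ℕ) : ℤ)) (i : Fin (d + 1)) :
    ⨆ k : ℤ, ⨆ _ : k ≤ ((i : ℕ) : ℤ), E k = inducedFlag U i := by
  refine le_antisymm (iSup₂_le fun k hk => ?_) (iSup₂_le fun j hj => ?_)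
  · by_cases h0 : k < 0
    · rw [hE k h0]; exact bot_le
    · have hi := i.isLt
      refine le_trans ?_
        (le_iSup₂_of_le (⟨k.toNat, by omega⟩ : Fin (d + 1)) (Fin.le_def.2 (by simp; omega)) le_rfl)
      rw [hU]
      exact le_of_eq (congrArg E (by simp; omega))
  · rw [hU]
    exact le_iSup₂_of_le ((j : ℕ) : ℤ) (by exact_mod_cast hj) le_rfl

theorem IsGraded.inducedFlag_eq {d : ℕ} {A : Module.End K V} (h : IsGraded d A) :
    inducedFlag (fun j : Fin (d + 1) => A.eigenspace (2 * ((j : ℕ) : K) - (d : K))) =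
      filtrationFlag d (eigenFiltration d A) := by
  funext i
  exact (iSup_le_eq_inducedFlag (fun k hk => h.eq_bot k (Or.inl hk)) (fun j => by simp) i).symm

theorem IsOnsagerPair.pairFlag_eq {d : ℕ} {A B : Module.End K V} (h : IsOnsagerPair d A B)
    (r : Fin 4) : pairFlag A B d r = filtrationFlag d (edgeFiltration d A B r) := by
  have h1 : ∀ (C : Module.End K V),
      (fun j : Fin (d + 1) => C.eigenspace ((d : K) - 2 * ((j : ℕ) : K))) =
      fun j : Fin (d + 1) => (-C).eigenspace (2 * ((j : ℕ) : K) - (d : K)) := by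
    intro C
    funext j
    rw [eigenspace_neg_eq, neg_sub]
  fin_cases r
  · exact h.left.inducedFlag_eq
  · exact (congrArg inducedFlag (h1 A)).trans h.left.neg.inducedFlag_eq
  · exact h.right.inducedFlag_eq
  · exact (congrArg inducedFlag (h1 B)).trans h.right.neg.inducedFlag_eq

theorem IsBoundedFiltration.isFlag {d : ℕ} {F : ℤ → Submodule K V} (hF : IsBoundedFiltration d F)
    (hlt : ∀ k : ℤ, 0 ≤ k → k ≤ d → F (k - 1) < F k) : IsFlag (filtrationFlag d F) := by
  have hstrict : StrictMono (filtrationFlag d F) := by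
    intro i j hij
    have hj := j.isLt
    have hij' : (i : ℕ) < j := hij
    exact (hF.mono (by lia : ((i : ℕ) : ℤ) ≤ ((j : ℕ) : ℤ) - 1)).trans_lt
      (hlt _ (by lia) (by lia))
  refine ⟨hstrict.injective, ?_, hstrict.monotone, hF.eq_top _ (by simp)⟩
  have h1 := bot_le.trans_lt (hlt 0 le_rfl (by lia))
  exact h1.ne'

theorem AreOpposite.inducedFlag_eq {d : ℕ} {F G : ℤ → Submodule K V} (h : AreOpposite d F G)
    (hF : IsBoundedFiltration d F) (hG : IsBoundedFiltration d G) :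
    inducedFlag (fun i : Fin (d + 1) => F ((i : ℕ) : ℤ) ⊓ G (d - ((i : ℕ) : ℤ))) =
      filtrationFlag d F := by
  funext i
  rw [← iSup_le_eq_inducedFlag (E := fun k => F k ⊓ G (d - k))
    (fun k hk => by rw [hF.eq_bot k hk, bot_inf_eq]) (fun _ => rfl)]
  exact le_antisymm (iSup₂_le fun k hk => inf_le_left.trans (hF.mono hk)) (h.le_iSup hF hG _)

theorem AreOpposite.isInducedDecomposition {d : ℕ} {F G : ℤ → Submodule K V}
    (h : AreOpposite d F G) (hF : IsBoundedFiltration d F) (hG : IsBoundedFiltration d G)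
    (hlt : ∀ k : ℤ, 0 ≤ k → k ≤ d → F (k - 1) < F k) :
    IsInducedDecomposition (filtrationFlag d F) (filtrationFlag d G)
      (fun i : Fin (d + 1) => F ((i : ℕ) : ℤ) ⊓ G (d - ((i : ℕ) : ℤ))) := by
  refine ⟨⟨fun i hi => ?_, ?_⟩, (h.inducedFlag_eq hF hG).symm, ?_⟩
  · have hid := i.isLt
    -- If the `i`-th piece were zero, `F i` would be the sum of the pieces with `k < i` and so be
    -- contained in `F (i - 1)`.
    refine (hlt ((i : ℕ) : ℤ) (by omega) (by omega)).not_ge ?_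
    refine (h.le_iSup hF hG _).trans (iSup₂_le fun k hk => ?_)
    rcases hk.eq_or_lt with rfl | hk
    · exact hi.le.trans bot_le
    · exact inf_le_left.trans (hF.mono (by lia))
  · refine DirectSum.isInternal_submodule_of_iSupIndep_of_iSup_eq_top
      ((h.iSupIndep hF hG).comp (f := fun i : Fin (d + 1) => ((i : ℕ) : ℤ)) fun i j hij =>
        Fin.ext (by simpa using hij)) ?_
    rw [eq_top_iff, ← hF.eq_top d le_rfl]
    have h1 := congrFun (h.inducedFlag_eq hF hG) (Fin.last d)
    simp only [filtrationFlag, Fin.val_last] at h1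
    rw [← h1]
    exact iSup₂_le fun j _ => _root_.le_iSup (fun i : Fin (d + 1) =>
      F ((i : ℕ) : ℤ) ⊓ G (d - ((i : ℕ) : ℤ))) j
  · rw [← h.symm.inducedFlag_eq hG hF]
    congr 1
    funext i
    have h1 : ((i.rev : ℕ) : ℤ) = d - ((i : ℕ) : ℤ) := by
      have := i.isLt
      rw [Fin.val_rev]; lia
    beta_reduce
    rw [h1, sub_sub_cancel, inf_comm]

theorem IsFlagMap.symm {d : ℕ} {f g : Fin (d + 1) → Submodule K V} {x : Module.End K V}
    (h : IsFlagMap f g x) : IsFlagMap g f (-x) := by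
  obtain ⟨U, ⟨⟨hne, hint⟩, hf, hg⟩, hx⟩ := h
  refine ⟨fun i => U i.rev, ⟨⟨fun i => hne _, ?_⟩, hg, by simpa using hf⟩, fun i => ?_⟩
  · exact DirectSum.isInternal_submodule_of_iSupIndep_of_iSup_eq_top
      (hint.submodule_iSupIndep.comp Fin.rev_injective)
      (by rw [← hint.submodule_iSup_eq_top]; exact Fin.rev_surjective.iSup_comp U)
  · beta_reduce
    rw [eigenspace_neg_eq, ← hx, Fin.val_rev]
    congr 1
    have hi : (i : ℕ) ≤ d := by have := i.isLt; lia
    rw [Nat.add_sub_add_right, Nat.cast_sub hi]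
    ring

theorem IsFlagMap.isAdapted {d : ℕ} {F : ℤ → Submodule K V} {g : Fin (d + 1) → Submodule K V}
    {x : Module.End K V} (hF : IsBoundedFiltration d F) (h : IsFlagMap (filtrationFlag d F) g x) :
    IsAdapted d x F := by
  obtain ⟨U, ⟨-, hf, -⟩, hx⟩ := h
  intro i v hv
  by_cases h0 : i < 0
  · rw [hF.eq_bot i h0] at hv
    rw [(Submodule.mem_bot K).1 hv]
    simp
  by_cases hd : (d : ℤ) < i
  · rw [hF.eq_top (i - 1) (by lia)]; trivial
  lift i to ℕ using by lia
  have h1 : inducedFlag U ⟨i, by lia⟩ ≤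
      (F (i - 1)).comap (x - (2 * (i : K) - (d : K)) • LinearMap.id) := by
    refine iSup₂_le fun j hj v hv => ?_
    have hv' := hv
    rw [← hx j, Module.End.mem_eigenspace_iff] at hv'
    rw [Submodule.mem_comap, LinearMap.sub_apply, hv', LinearMap.smul_apply, LinearMap.id_apply,
      ← sub_smul]
    have hj' : (j : ℕ) ≤ i := hj
    rcases hj'.eq_or_lt with rfl | hj'
    · simp
    · refine Submodule.smul_mem _ _ (hF.mono (by lia : ((j : ℕ) : ℤ) ≤ i - 1) ?_)
      have h2 : v ∈ inducedFlag U j := (le_iSup₂_of_le j le_rfl le_rfl : U j ≤ inducedFlag U j) hv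
      rw [← hf] at h2
      exact h2
  rw [← hf] at h1
  simpa using h1 hv

theorem IsGraded.endDiagonalizable {d : ℕ} {A : Module.End K V} (h : IsGraded d A) :
    EndDiagonalizable A := by
  rw [EndDiagonalizable, eq_top_iff, ← h.span]
  exact iSup_le fun k => le_iSup A.eigenspace _

variable [CharZero K]

/-- A flag map is adapted to `F`, and its negative to `G`, so it is the split map. Conversely,
eigenvectors of the split map for `2i - d` descend into both `F i` and `G (d - i)`, so its
eigenspaces are exactly the pieces. -/
theorem isFlagMap_iff {d : ℕ} {F G : ℤ → Submodule K V} {x : Module.End K V}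
    (h : AreOpposite d F G) (hF : IsBoundedFiltration d F) (hG : IsBoundedFiltration d G)
    (hlt : ∀ k : ℤ, 0 ≤ k → k ≤ d → F (k - 1) < F k) :
    IsFlagMap (filtrationFlag d F) (filtrationFlag d G) x ↔ IsSplitMap d F G x := by
  refine ⟨fun hx => isSplitMap_of_isAdapted hF hG (hx.isAdapted hF) (hx.symm.isAdapted hG),
    fun hx => ⟨_, h.isInducedDecomposition hF hG hlt, fun i => le_antisymm (fun v hv => ?_)
      fun v hv => ?_⟩⟩
  · rw [Module.End.mem_eigenspace_iff] at hv
    refine ⟨(hx.isAdapted h hF hG).mem_of_apply_eq hF (by simpa using hv),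
      (hx.symm.isAdapted h.symm hG hF).mem_of_apply_eq hG ?_⟩
    rw [LinearMap.neg_apply, hv]
    push_cast
    module
  · rw [Module.End.mem_eigenspace_iff]
    simpa using hx _ v hv.1 hv.2

theorem IsOnsagerPair.edgeFiltration_lt {d : ℕ} {A B : Module.End K V} (h : IsOnsagerPair d A B)
    (r : Fin 4) (k : ℤ) (h0 : 0 ≤ k) (hd : k ≤ d) :
    edgeFiltration d A B r (k - 1) < edgeFiltration d A B r k := by
  fin_cases r
  · exact eigenFiltration_lt_of_ne_bot h.left (h.left_ne_bot k h0 hd)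
  · exact eigenFiltration_lt_of_ne_bot h.left.neg (h.neg_left.left_ne_bot k h0 hd)
  · exact eigenFiltration_lt_of_ne_bot h.right (h.right_ne_bot k h0 hd)
  · exact eigenFiltration_lt_of_ne_bot h.right.neg (h.neg_right.right_ne_bot k h0 hd)

theorem IsOnsagerPair.isFlag_pairFlag {d : ℕ} {A B : Module.End K V} (h : IsOnsagerPair d A B)
    (r : Fin 4) : IsFlag (pairFlag A B d r) := by
  rw [h.pairFlag_eq]
  exact (h.isBoundedFiltration r).isFlag (h.edgeFiltration_lt r)

theorem IsOnsagerPair.oppositeFlags_pairFlag {d : ℕ} {A B : Module.End K V}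
    (h : IsOnsagerPair d A B) {r s : Fin 4} (hrs : r ≠ s) :
    OppositeFlags (pairFlag A B d r) (pairFlag A B d s) := by
  rw [h.pairFlag_eq, h.pairFlag_eq]
  exact ⟨_, (h.areOpposite_edgeFiltration hrs).isInducedDecomposition (h.isBoundedFiltration r)
    (h.isBoundedFiltration s) (h.edgeFiltration_lt r)⟩

theorem IsOnsagerPair.isFlagMap_pairFlag_iff {d : ℕ} {A B : Module.End K V}
    (h : IsOnsagerPair d A B) {r s : Fin 4} (hrs : r ≠ s) {x : Module.End K V} :
    IsFlagMap (pairFlag A B d r) (pairFlag A B d s) x ↔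
      IsSplitMap d (edgeFiltration d A B r) (edgeFiltration d A B s) x := by
  rw [h.pairFlag_eq, h.pairFlag_eq]
  exact isFlagMap_iff (h.areOpposite_edgeFiltration hrs) (h.isBoundedFiltration r)
    (h.isBoundedFiltration s) (h.edgeFiltration_lt r)

theorem IsOnsagerPair.existsUnique_isFlagMap {d : ℕ} {A B : Module.End K V}
    (h : IsOnsagerPair d A B) {r s : Fin 4} (hrs : r ≠ s) :
    ∃! x : Module.End K V, IsFlagMap (pairFlag A B d r) (pairFlag A B d s) x := by
  simp only [h.isFlagMap_pairFlag_iff hrs]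
  have hopp := h.areOpposite_edgeFiltration hrs
  obtain ⟨x, hx⟩ := hopp.exists_isSplitMap (h.isBoundedFiltration r) (h.isBoundedFiltration s)
  exact ⟨x, hx, fun y hy => hopp.ext fun i v hi hj => by rw [hx i v hi hj, hy i v hi hj]⟩

theorem IsOnsagerPair.eq_of_isFlagMap {d : ℕ} {A B : Module.End K V} (h : IsOnsagerPair d A B)
    {x y : Module.End K V} (hx : IsFlagMap (pairFlag A B d 0) (pairFlag A B d 1) x)
    (hy : IsFlagMap (pairFlag A B d 2) (pairFlag A B d 3) y) : x = A ∧ y = B := by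
  have h01 : (0 : Fin 4) ≠ 1 := by decide
  have h23 : (2 : Fin 4) ≠ 3 := by decide
  exact ⟨(h.existsUnique_isFlagMap h01).unique hx ((h.isFlagMap_pairFlag_iff h01).2
      (isSplitMap_of_isAdapted (h.isBoundedFiltration 0) (h.isBoundedFiltration 1)
        (isAdapted_eigenFiltration d A) (isAdapted_eigenFiltration d (-A)))),
    (h.existsUnique_isFlagMap h23).unique hy ((h.isFlagMap_pairFlag_iff h23).2
      (isSplitMap_of_isAdapted (h.isBoundedFiltration 2) (h.isBoundedFiltration 3)
        (isAdapted_eigenFiltration d B) (isAdapted_eigenFiltration d (-B))))⟩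

theorem IsOnsagerPair.isStandardEigenvalueSeq {d : ℕ} {A B : Module.End K V}
    (h : IsOnsagerPair d A B) :
    IsStandardEigenvalueSeq A B d fun i => 2 * ((i : ℕ) : K) - (d : K) := by
  have hd : ∀ i : Fin (d + 1), (i : ℕ) ≤ d := fun i => by have := i.isLt; lia
  refine ⟨fun i j hij => ?_, ?_, fun i => ?_⟩
  · have h1 : ((i : ℕ) : K) = ((j : ℕ) : K) := by
      simpa using hij
    exact Fin.ext (by exact_mod_cast h1)
  · ext μ
    constructor
    · rintro ⟨i, rfl⟩
      have := h.left_ne_bot ((i : ℕ) : ℤ) (by simp) (by exact_mod_cast hd i)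
      rwa [Int.cast_natCast] at this
    · intro hμ
      obtain ⟨k, hk, rfl⟩ := h.left.exists_of_hasEigenvalue hμ
      exact ⟨⟨k, by lia⟩, rfl⟩
  · rw [Submodule.map_le_iff_le_comap]
    intro v hv
    have hle : ∀ k : ℤ, k ≤ (i : ℕ) + 1 → ((i : ℕ) : ℤ) ≤ k + 1 →
        A.eigenspace (2 * (k : K) - (d : K)) ≤
          ⨆ j : Fin (d + 1), ⨆ _ : (j : ℕ) ≤ (i : ℕ) + 1 ∧ (i : ℕ) ≤ (j : ℕ) + 1,
            A.eigenspace (2 * ((j : ℕ) : K) - (d : K)) := by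
      intro k h1 h2
      by_cases hk : k < 0 ∨ (d : ℤ) < k
      · rw [h.left.eq_bot k hk]; exact bot_le
      · lift k to ℕ using by omega
        refine le_iSup₂_of_le (⟨k, by omega⟩ : Fin (d + 1)) ⟨by simp; omega, by simp; omega⟩ ?_
        simp
    have h1 := apply_mem_of_dolanGrady h.dolanGrady_left hv
    rw [Submodule.mem_comap]
    refine SetLike.le_def.1 (sup_le (sup_le ?_ ?_) ?_) h1
    · convert hle (((i : ℕ) : ℤ) - 1) (by lia) (by lia) using 2
      push_cast; ring
    · simpa using hle ((i : ℕ) : ℤ) (by lia) (by lia)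
    · convert hle (((i : ℕ) : ℤ) + 1) (by lia) (by lia) using 2
      push_cast; ring

theorem IsOnsagerPair.isTridiagonalPair {d : ℕ} {A B : Module.End K V} (h : IsOnsagerPair d A B) :
    IsTridiagonalPair A B := by
  refine ⟨h.left.endDiagonalizable, h.right.endDiagonalizable, ⟨d, _, h.isStandardEigenvalueSeq⟩,
    ⟨d, _, h.swap.isStandardEigenvalueSeq⟩, ?_⟩
  rintro ⟨W, hA, hB, hbot, htop⟩
  exact (h.irreducible W (Submodule.map_le_iff_le_comap.1 hA)
    (Submodule.map_le_iff_le_comap.1 hB)).elim hbot htop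

end Flags

/-! ### Irreducible tetrahedron families -/

section Irreducible

variable {K : Type u} {V : Type v} [Field K] [AddCommGroup V] [Module K V]

/-! ### Dolan-Grady relations between arbitrary edges -/

theorem dolanGrady_neg_right {x y : Module.End K V} (h : ⁅x, ⁅x, ⁅x, y⁆⁆⁆ = (4 : K) • ⁅x, y⁆) :
    ⁅x, ⁅x, ⁅x, -y⁆⁆⁆ = (4 : K) • ⁅x, -y⁆ := by
  simp only [LieRing.of_associative_ring_bracket, neg_mul, mul_neg, mul_sub, sub_mul,
    smul_sub] at h ⊢
  linear_combination (norm := module) -h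

/-- Since `[x, y] = 2x + 2y`, the operator `ad x` multiplies `[x, y]` by `2`; for the reversed
relation the factor is `-2`. Both square to `4`. -/
theorem dolanGrady_of_bracket {x y : Module.End K V}
    (h : x * y - y * x = (2 : K) • x + (2 : K) • y) :
    ⁅x, ⁅x, ⁅x, y⁆⁆⁆ = (4 : K) • ⁅x, y⁆ := by
  have h1 : x * (x * y - y * x) - (x * y - y * x) * x = (2 : K) • (x * y - y * x) := by
    nth_rewrite 1 2 [h]
    simp only [mul_add, add_mul, mul_smul_comm, smul_mul_assoc]
    module
  simp only [LieRing.of_associative_ring_bracket]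
  rw [h1, mul_smul_comm, smul_mul_assoc, ← smul_sub, h1, smul_smul]
  norm_num

theorem dolanGrady_of_bracket' {x y : Module.End K V}
    (h : y * x - x * y = (2 : K) • y + (2 : K) • x) :
    ⁅x, ⁅x, ⁅x, y⁆⁆⁆ = (4 : K) • ⁅x, y⁆ := by
  have h0 : x * y - y * x = (-2 : K) • x + (-2 : K) • y := by
    linear_combination (norm := module) -h
  have h1 : x * (x * y - y * x) - (x * y - y * x) * x = (-2 : K) • (x * y - y * x) := by
    nth_rewrite 1 2 [h0]
    simp only [mul_add, add_mul, mul_smul_comm, smul_mul_assoc]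
    module
  simp only [LieRing.of_associative_ring_bracket]
  rw [h1, mul_smul_comm, smul_mul_assoc, ← smul_sub, h1, smul_smul]
  norm_num

/-- The Dolan-Grady relation holds between any two edges. -/
theorem IsTetrahedronFamily.dolanGrady_all {X : Fin 4 → Fin 4 → Module.End K V}
    (h : IsTetrahedronFamily X) {r s p q : Fin 4} (hrs : r ≠ s) (hpq : p ≠ q) :
    ⁅X r s, ⁅X r s, ⁅X r s, X p q⁆⁆⁆ = (4 : K) • ⁅X r s, X p q⁆ := by
  have hstart : ∀ q, s ≠ q → ⁅X r s, ⁅X r s, ⁅X r s, X s q⁆⁆⁆ = (4 : K) • ⁅X r s, X s q⁆ := by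
    intro q hsq
    by_cases hrq : r = q
    · subst hrq
      rw [h.skew r s hrs]
      simp [LieRing.of_associative_ring_bracket]
    · exact dolanGrady_of_bracket (h.triangle r s q hrs hsq hrq)
  have hend : ∀ p, p ≠ r → ⁅X r s, ⁅X r s, ⁅X r s, X p r⁆⁆⁆ = (4 : K) • ⁅X r s, X p r⁆ := by
    intro p hpr
    by_cases hps : p = s
    · subst hps
      exact hstart r hrs.symm
    · exact dolanGrady_of_bracket' (h.triangle p r s hpr hrs hps)
  by_cases h1 : p = s
  · subst h1; exact hstart q hpq
  by_cases h2 : q = r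
  · subst h2; exact hend p hpq
  by_cases h3 : p = r
  · subst h3
    rw [h.skew q p hpq.symm]
    exact dolanGrady_neg_right (hend q h2)
  by_cases h4 : q = s
  · subst h4
    rw [h.skew q p hpq.symm]
    exact dolanGrady_neg_right (hstart p hpq.symm)
  exact h.dolanGrady r s p q hrs (Ne.symm h3) (Ne.symm h2) (Ne.symm h1) (Ne.symm h4) hpq

/-- An invariant subspace is the sum of its intersections with the eigenspaces of `A`; if those
below index `i` vanish, the rest lie in the filtration taken from the other end. -/
theorem IsGraded.le_eigenFiltration_neg [FiniteDimensional K V] {d : ℕ} {A : Module.End K V} (hA : IsGraded d A)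
    {W : Submodule K V} (hW : W ≤ W.comap A) {i : ℤ}
    (h : eigenFiltration d A (i - 1) ⊓ W = ⊥) : W ≤ eigenFiltration d (-A) (d - i) := by
  have h1 : W = ⨆ μ, W ⊓ A.eigenspace μ := by
    have h2 := Submodule.inf_iSup_genEigenspace (p := W) (f := A) hW 1
    rw [show ⨆ μ, A.genEigenspace μ 1 = ⊤ from hA.endDiagonalizable, inf_top_eq] at h2
    exact h2
  rw [h1]
  refine iSup_le fun μ => ?_
  by_cases hμ : A.HasEigenvalue μ
  · obtain ⟨k, -, rfl⟩ := hA.exists_of_hasEigenvalue hμ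
    by_cases hk : (k : ℤ) ≤ i - 1
    · have h2 := eigenspace_le_eigenFiltration d A hk
      rw [Int.cast_natCast] at h2
      rw [inf_comm]
      exact (inf_le_inf_right W h2).trans (h.le.trans bot_le)
    · have h2 := eigenspace_le_eigenFiltration d (-A) (by lia : (d : ℤ) - k ≤ d - i)
      rw [eigenspace_neg_sub, Int.cast_natCast] at h2
      exact inf_le_right.trans h2
  · rw [show A.eigenspace μ = ⊥ from not_not.1 hμ, inf_bot_eq]
    exact bot_le

variable [CharZero K] [FiniteDimensional K V]

/-- Starting from an eigenvalue and proceeding in steps of `c`, one eventually leaves the set of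
eigenvalues. -/
theorem exists_maximal_eigenvalue (x : Module.End K V) {μ c : K} (hc : c ≠ 0)
    (hμ : x.HasEigenvalue μ) :
    ∃ n : ℕ, (∀ k ≤ n, x.HasEigenvalue (μ + k * c)) ∧
      ¬x.HasEigenvalue (μ + ((n + 1 : ℕ) : K) * c) := by
  classical
  have hex : ∃ n : ℕ, ¬x.HasEigenvalue (μ + (n : K) * c) := by
    by_contra! hall
    have hinj : Function.Injective fun n : ℕ => μ + (n : K) * c := fun m n hmn => by
      have h1 : (m : K) * c = (n : K) * c := add_left_cancel hmn
      exact_mod_cast mul_right_cancel₀ hc h1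
    exact Set.infinite_of_injective_forall_mem hinj hall x.finite_hasEigenvalue
  have hpos : Nat.find hex ≠ 0 := by
    intro h0
    have := Nat.find_spec hex
    rw [h0] at this
    simp [hμ] at this
  obtain ⟨n, hn⟩ := Nat.exists_eq_succ_of_ne_zero hpos
  refine ⟨n, fun k hk => ?_, ?_⟩
  · by_contra h1
    exact Nat.find_min hex (by lia) h1
  · have := Nat.find_spec hex
    rwa [hn] at this

/-- The eigenvalues of consecutive edges are opposite. -/
theorem hasEigenvalue_neg_of_bracket {x y : Module.End K V}
    (h : x * y - y * x = (2 : K) • x + (2 : K) • y) {μ : K} (hμ : x.HasEigenvalue μ) :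
    y.HasEigenvalue (-μ) := by
  -- `x + y` raises eigenvalues of `x` by `2`, and on the `k`-th summand `y + μ = (x + y) - 2k`. So
  -- `y + μ` maps `P 0` into the strictly smaller `P 1` and cannot be injective.
  set P : ℕ → Submodule K V := fun n => ⨆ k : ℕ, ⨆ _ : n ≤ k, x.eigenspace (μ + k * 2) with hP
  have hmap : (P 0).map (y - (-μ) • LinearMap.id) ≤ P 1 := by
    rw [Submodule.map_le_iff_le_comap]
    refine iSup₂_le fun k _ v hv => ?_
    have hv1 := Module.End.mem_eigenspace_iff.1 hv
    have hh := LinearMap.congr_fun h v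
    simp only [LinearMap.sub_apply, Module.End.mul_apply, LinearMap.add_apply,
      LinearMap.smul_apply, hv1, map_smul] at hh
    have h1 : x v + y v ∈ P 1 := by
      refine (le_iSup₂_of_le (k + 1) (by lia) le_rfl :
        x.eigenspace (μ + ((k + 1 : ℕ) : K) * 2) ≤ P 1) (Module.End.mem_eigenspace_iff.2 ?_)
      rw [map_add, hv1, map_smul, hv1]
      push_cast
      linear_combination (norm := module) hh
    have h2 : (k : K) • v ∈ P 1 := by
      rcases Nat.eq_zero_or_pos k with rfl | hk
      · simp
      · exact Submodule.smul_mem _ _ ((le_iSup₂_of_le k hk le_rfl :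
          x.eigenspace (μ + (k : K) * 2) ≤ P 1) hv)
    have h3 := sub_mem h1 ((P 1).smul_mem (2 : K) h2)
    rw [Submodule.mem_comap, LinearMap.sub_apply, LinearMap.smul_apply, LinearMap.id_apply]
    convert h3 using 1
    rw [hv1]
    module
  have hlt : P 1 < P 0 := by
    refine lt_of_le_of_ne (iSup₂_le fun k hk => le_iSup₂_of_le k (Nat.zero_le k) le_rfl)
      fun heq => hμ ?_
    have h1 : x.eigenspace μ ≤ P 0 :=
      le_iSup₂_of_le 0 le_rfl (by simp)
    rw [← heq] at h1
    refine disjoint_self.1 ((x.eigenspaces_iSupIndep μ).mono_right (h1.trans ?_))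
    refine iSup₂_le fun k hk => le_iSup₂_of_le (μ + (k : K) * 2) ?_ le_rfl
    have : (k : K) ≠ 0 := by exact_mod_cast (by lia : k ≠ 0)
    simpa using this
  intro hbot
  have hker : LinearMap.ker (y - (-μ) • LinearMap.id) = ⊥ := by
    rw [Submodule.eq_bot_iff]
    intro v hv
    have h1 : v ∈ y.eigenspace (-μ) := by
      rw [Module.End.mem_eigenspace_iff]
      exact sub_eq_zero.1 hv
    exact (show y.eigenspace (-μ) = ⊥ from hbot).le h1
  have h1 := Submodule.finrank_mono hmap
  rw [← (Submodule.equivMapOfInjective _ (LinearMap.ker_eq_bot.1 hker) (P 0)).finrank_eq] at h1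
  exact h1.not_gt (Submodule.finrank_lt_finrank_of_lt hlt)

variable {X : Fin 4 → Fin 4 → Module.End K V}

theorem IsTetrahedronFamily.hasEigenvalue_neg (h : IsTetrahedronFamily X) {r s t : Fin 4}
    (hrs : r ≠ s) (hst : s ≠ t) (hrt : r ≠ t) {μ : K} (hμ : (X r s).HasEigenvalue μ) :
    (X s t).HasEigenvalue (-μ) :=
  hasEigenvalue_neg_of_bracket (h.triangle r s t hrs hst hrt) hμ

/-- Going once around a triangle changes the sign three times. -/
theorem IsTetrahedronFamily.hasEigenvalue_neg_self (h : IsTetrahedronFamily X) {r s : Fin 4}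
    (hrs : r ≠ s) {μ : K} (hμ : (X r s).HasEigenvalue μ) : (X r s).HasEigenvalue (-μ) := by
  obtain ⟨t, hrt, hst⟩ : ∃ t, r ≠ t ∧ s ≠ t := by
    clear hμ
    revert r s
    decide
  have h1 := h.hasEigenvalue_neg hst hrt.symm hrs.symm (h.hasEigenvalue_neg hrs hst hrt hμ)
  exact h.hasEigenvalue_neg hrt.symm hrs hst.symm (by rwa [neg_neg] at h1)

theorem IsTetrahedronFamily.hasEigenvalue (h : IsTetrahedronFamily X) {r s p q : Fin 4}
    (hrs : r ≠ s) (hpq : p ≠ q) {μ : K} (hμ : (X r s).HasEigenvalue μ) :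
    (X p q).HasEigenvalue μ := by
  have hflip : ∀ {r s : Fin 4}, r ≠ s → (X r s).HasEigenvalue μ → (X s r).HasEigenvalue μ := by
    intro r s hrs hμ
    have h1 := h.hasEigenvalue_neg_self hrs hμ
    intro (h2 : (X s r).eigenspace μ = ⊥)
    rw [h.skew r s hrs, eigenspace_neg_eq] at h2
    exact h1 h2
  have hstep : ∀ {r s t : Fin 4}, r ≠ s → s ≠ t → (X r s).HasEigenvalue μ →
      (X s t).HasEigenvalue μ := by
    intro r s t hrs hst hμ
    by_cases hrt : r = t
    · subst hrt; exact hflip hrs hμ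
    · simpa using h.hasEigenvalue_neg_self hst (h.hasEigenvalue_neg hrs hst hrt hμ)
  by_cases h1 : p = s
  · subst h1; exact hstep hrs hpq hμ
  · exact hstep (Ne.symm h1) hpq (hstep hrs (Ne.symm h1) hμ)

/-- The edges of an irreducible tetrahedron family are diagonalizable, with eigenvalues forming a
string. -/
theorem IsTetrahedronFamily.exists_string [IsAlgClosed K] [Nontrivial V]
    (h : IsTetrahedronFamily X)
    (hirr : ∀ W : Submodule K V, (∀ r s, r ≠ s → W ≤ W.comap (X r s)) → W = ⊥ ∨ W = ⊤)
    {r s : Fin 4} (hrs : r ≠ s) :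
    ∃ (μ : K) (n : ℕ), (∀ k ≤ n, (X r s).HasEigenvalue (μ + k * 2)) ∧
      ⨆ k : ℕ, ⨆ _ : k ≤ n, (X r s).eigenspace (μ + k * 2) = ⊤ := by
  obtain ⟨ν, hν⟩ := Module.End.exists_eigenvalue (X r s)
  -- Descend by `2` to the bottom `μ` of the string through `ν`, then ascend to its top. By
  -- Dolan-Grady no edge leads out of the sum of these eigenspaces, since the eigenvalues just
  -- beyond both ends are missing.
  obtain ⟨m, hm, hm'⟩ := exists_maximal_eigenvalue (X r s) (c := -2) (by norm_num) hν
  set μ : K := ν + m * (-2) with hμ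
  obtain ⟨n, hn, hn'⟩ := exists_maximal_eigenvalue (X r s) (c := 2) two_ne_zero (hm m le_rfl)
  refine ⟨μ, n, hn, ?_⟩
  set W := ⨆ k : ℕ, ⨆ _ : k ≤ n, (X r s).eigenspace (μ + k * 2) with hW
  have hle : ∀ k ≤ n, (X r s).eigenspace (μ + k * 2) ≤ W := fun k hk =>
    le_iSup₂_of_le k hk le_rfl
  refine (hirr W fun p q hpq => ?_).resolve_left fun hbot => ?_
  · refine iSup₂_le fun k hk v hv => ?_
    rw [Submodule.mem_comap]
    refine SetLike.le_def.1 (sup_le (sup_le ?_ (hle k hk)) ?_)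
      (apply_mem_of_dolanGrady (h.dolanGrady_all hrs hpq) hv)
    · rcases Nat.eq_zero_or_pos k with rfl | hk0
      · have h1 : (X r s).eigenspace (ν + ((m + 1 : ℕ) : K) * -2) = ⊥ := not_not.1 hm'
        have h2 : μ + ((0 : ℕ) : K) * 2 - 2 = ν + ((m + 1 : ℕ) : K) * -2 := by
          rw [hμ]; push_cast; ring
        rw [h2, h1]
        exact bot_le
      · convert hle (k - 1) (by lia) using 2
        rw [Nat.cast_sub hk0]
        push_cast; ring
    · rcases hk.eq_or_lt with rfl | hkn
      · have h1 : (X r s).eigenspace (μ + ((k + 1 : ℕ) : K) * 2) = ⊥ := not_not.1 hn'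
        have h2 : μ + (k : K) * 2 + 2 = μ + ((k + 1 : ℕ) : K) * 2 := by
          push_cast; ring
        rw [h2, h1]
        exact bot_le
      · convert hle (k + 1) hkn using 2
        push_cast; ring
  · refine hn 0 (Nat.zero_le n) (eq_bot_iff.2 ?_)
    rw [← hbot]
    exact hle 0 (Nat.zero_le n)

theorem IsTetrahedronFamily.exists_isGraded [IsAlgClosed K] [Nontrivial V]
    (h : IsTetrahedronFamily X)
    (hirr : ∀ W : Submodule K V, (∀ r s, r ≠ s → W ≤ W.comap (X r s)) → W = ⊥ ∨ W = ⊤)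
    {r s : Fin 4} (hrs : r ≠ s) :
    ∃ n : ℕ, IsGraded n (X r s) ∧
      ∀ k : ℕ, k ≤ n → (X r s).HasEigenvalue (2 * (k : K) - (n : K)) := by
  obtain ⟨μ, n, hn, htop⟩ := h.exists_string hirr hrs
  have hstring : ∀ ν, (X r s).HasEigenvalue ν → ∃ k ≤ n, ν = μ + (k : K) * 2 := by
    intro ν hν
    by_contra! hne
    refine hν (disjoint_self.1 (((X r s).eigenspaces_iSupIndep ν).mono_right ?_))
    refine le_trans le_top (htop ▸ iSup₂_le fun k hk => ?_)
    exact le_iSup₂_of_le (μ + (k : K) * 2) (hne k hk).symm le_rfl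
  obtain ⟨k, hk, hk'⟩ := hstring _ (h.hasEigenvalue_neg_self hrs (hn 0 (Nat.zero_le n)))
  obtain ⟨j, hj, hj'⟩ := hstring _ (h.hasEigenvalue_neg_self hrs (hn n le_rfl))
  -- Negation maps the bottom of the string to position `k` and the top to position `j`. The
  -- difference gives `k = n + j`, so `k ≤ n` forces `k = n`, that is, `μ = -n`.
  have hkj : k = n + j := by
    have h1 : (k : K) = (n : K) + j := by
      have h2 : (2 : K) * k = 2 * (n + j) := by
        push_cast at hk' hj'
        linear_combination hj' - hk'
      exact mul_left_cancel₀ two_ne_zero h2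
    exact_mod_cast h1
  have hkn : k = n := by lia
  have hμ : μ = -(n : K) := by
    have h2 : (2 : K) * μ = 2 * (-(n : K)) := by
      rw [hkn] at hk'
      push_cast at hk'
      linear_combination -hk'
    exact mul_left_cancel₀ two_ne_zero h2
  have hcoe : ∀ k : ℕ, μ + (k : K) * 2 = 2 * (k : K) - n := fun k => by rw [hμ]; ring
  refine ⟨n, ⟨?_, fun k hk => ?_⟩, fun k hk => hcoe k ▸ hn k hk⟩
  · rw [eq_top_iff, ← htop]
    refine iSup₂_le fun k _ => ?_
    rw [hcoe]
    simpa using le_iSup (fun k : ℤ => (X r s).eigenspace (2 * (k : K) - (n : K))) (k : ℤ)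
  · by_contra hne
    obtain ⟨j, hj, hj'⟩ := hstring _ hne
    rw [hcoe] at hj'
    have h1 : (2 : K) * (k : K) = 2 * ((j : ℤ) : K) := by
      push_cast
      linear_combination hj'
    have h2 : k = j := by exact_mod_cast mul_left_cancel₀ two_ne_zero h1
    lia

/-- All edges of an irreducible tetrahedron family are diagonalizable, with the same eigenvalues
`-d, 2 - d, …, d`. -/
theorem IsTetrahedronFamily.exists_isGraded_all [IsAlgClosed K] [Nontrivial V]
    (h : IsTetrahedronFamily X)
    (hirr : ∀ W : Submodule K V, (∀ r s, r ≠ s → W ≤ W.comap (X r s)) → W = ⊥ ∨ W = ⊤) :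
    ∃ d : ℕ, ∀ r s, r ≠ s → IsGraded d (X r s) ∧
      ∀ k : ℕ, k ≤ d → (X r s).HasEigenvalue (2 * (k : K) - (d : K)) := by
  have h01 : (0 : Fin 4) ≠ 1 := by decide
  obtain ⟨d, hd, hd'⟩ := h.exists_isGraded hirr h01
  refine ⟨d, fun r s hrs => ?_⟩
  obtain ⟨n, hn, hn'⟩ := h.exists_isGraded hirr hrs
  have hle : ∀ {a b : ℕ} {x : Module.End K V}, IsGraded b x →
      x.HasEigenvalue (2 * (a : K) - (a : K)) → a ≤ b := by
    intro a b x hx ha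
    obtain ⟨k, hk, hk'⟩ := hx.exists_of_hasEigenvalue ha
    have h1 : ((a + b : ℕ) : K) = ((2 * k : ℕ) : K) := by
      push_cast
      linear_combination hk'
    have h2 : a + b = 2 * k := by exact_mod_cast h1
    lia
  have hnd : n = d := le_antisymm (hle hd (h.hasEigenvalue hrs h01 (hn' n le_rfl)))
    (hle hn (h.hasEigenvalue h01 hrs (hd' d le_rfl)))
  subst hnd
  exact ⟨hn, hn'⟩

/-! ### Irreducibility under two opposite edges -/

/-- A minimal invariant subspace is spanned by its intersections with the split decomposition of
the whole space. -/
theorem le_antidiagonalSum_of_minimal {d : ℕ} {A B : Module.End K V} (hA : IsGraded d A)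
    (hB : IsGraded d B) (hAB : ⁅A, ⁅A, ⁅A, B⁆⁆⁆ = (4 : K) • ⁅A, B⁆)
    (hBA : ⁅B, ⁅B, ⁅B, A⁆⁆⁆ = (4 : K) • ⁅B, A⁆)
    (hneg : AreOpposite d (eigenFiltration d (-A)) (eigenFiltration d (-B)))
    {W : Submodule K V} (hWA : W ≤ W.comap A) (hWB : W ≤ W.comap B) (hW : W ≠ ⊥)
    (hmin : ∀ W' ≤ W, W' ≤ W'.comap A → W' ≤ W'.comap B → W' = ⊥ ∨ W' = W) :
    W ≤ ⨆ i : ℤ, eigenFiltration d A i ⊓ eigenFiltration d B (d - i) ⊓ W := by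
  set F : ℤ → Submodule K V := fun i => eigenFiltration d A i ⊓ W with hF
  set G : ℤ → Submodule K V := fun i => eigenFiltration d B i ⊓ W with hG
  have hadapt : ∀ {C : Module.End K V}, W ≤ W.comap C →
      IsAdapted d C (fun i => eigenFiltration d C i ⊓ W) := fun hC i v hv =>
    ⟨isAdapted_eigenFiltration d _ i v hv.1, sub_mem (hC hv.2) (W.smul_mem _ hv.2)⟩
  have hFm : Monotone F := fun i j hij => inf_le_inf_right W (hA.isBoundedFiltration.mono hij)
  have hGm : Monotone G := fun i j hij => inf_le_inf_right W (hB.isBoundedFiltration.mono hij)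
  have hFs : Shifts B F := fun i v hv => ⟨shifts_of_dolanGrady d hAB i v hv.1, hWB hv.2⟩
  have hGs : Shifts A G := fun i v hv => ⟨shifts_of_dolanGrady d hBA i v hv.1, hWA hv.2⟩
  have hZW : antidiagonalSum F G d ≤ W := iSup_le fun i => inf_le_left.trans inf_le_right
  rcases hmin _ hZW (antidiagonalSum_le_comap hGm (hadapt hWA) hGs d) (by
      rw [antidiagonalSum_comm]
      exact antidiagonalSum_le_comap hFm (hadapt hWB) hFs d) with hZ | hZ
  -- Let `e` be the first step of the filtration of `A` meeting `W`, and `g` the first step of that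
  -- of `B` containing `W`. If `e + g ≤ d`, the nonzero `F e` lies in the sum assumed to vanish. If
  -- `e + g > d`, then `W` lies in step `d - e` of the filtration of `-A` and meets step `d - g` of
  -- that of `-B`, although these steps have total index below `d`.
  · exfalso
    obtain ⟨e, he, hemin⟩ := Int.exists_least_of_bdd (P := fun i => F i ≠ ⊥)
      ⟨0, fun i hi => by
        by_contra hneg
        exact hi (by simp [hF, hA.isBoundedFiltration.eq_bot i (by lia)])⟩
      ⟨d, by simpa [hF, hA.isBoundedFiltration.eq_top d le_rfl] using hW⟩
    obtain ⟨g, hg, hgmin⟩ := Int.exists_least_of_bdd (P := fun i => W ≤ eigenFiltration d B i)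
      ⟨0, fun i hi => by
        by_contra hneg
        rw [hB.isBoundedFiltration.eq_bot i (by lia), le_bot_iff] at hi
        exact hW hi⟩
      ⟨d, by rw [hB.isBoundedFiltration.eq_top d le_rfl]; exact le_top⟩
    have h1 : W ≤ eigenFiltration d (-A) (d - e) := by
      refine hA.le_eigenFiltration_neg hWA ?_
      by_contra hne
      have := hemin (e - 1) hne
      lia
    have h2 : eigenFiltration d (-B) (d - g) ⊓ W ≠ ⊥ := by
      intro hbot
      have h3 := hB.neg.le_eigenFiltration_neg (W := W) (i := d - g + 1)
        (fun v hv => by simpa using neg_mem (hWB hv)) (by rwa [add_sub_cancel_right])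
      rw [neg_neg] at h3
      have := hgmin _ h3
      lia
    have h3 : (d : ℤ) < e + g := by
      by_contra hle
      refine he (eq_bot_iff.2 ?_)
      rw [← hZ]
      refine le_trans (fun v hv => ?_) (le_iSup (fun i => F i ⊓ G (d - i)) e)
      exact ⟨hv, hB.isBoundedFiltration.mono (by lia) (hg hv.2), hv.2⟩
    refine h2 ((Submodule.eq_bot_iff _).2 fun v hv => ?_)
    exact hneg.disjoint (d - e) (d - g) v (by lia) (h1 hv.2) hv.1
  · nth_rewrite 1 [← hZ]
    refine iSup_mono fun i v hv => ⟨⟨hv.1.1, hv.2.1⟩, hv.1.2⟩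

/-- The edges `01` and `23` of an irreducible tetrahedron family act irreducibly. -/
theorem IsTetrahedronFamily.exists_isOnsagerPair [IsAlgClosed K] [Nontrivial V]
    (h : IsTetrahedronFamily X)
    (hirr : ∀ W : Submodule K V, (∀ r s, r ≠ s → W ≤ W.comap (X r s)) → W = ⊥ ∨ W = ⊤) :
    ∃ d : ℕ, IsOnsagerPair d (X 0 1) (X 2 3) := by
  obtain ⟨d, hd⟩ := h.exists_isGraded_all hirr
  have hF : ∀ r, IsBoundedFiltration d (eigenFiltration d (X r (partner r))) := fun r =>
    (hd _ _ (ne_partner r)).1.isBoundedFiltration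
  have hopp : ∀ r s, r ≠ s → AreOpposite d (eigenFiltration d (X r (partner r)))
      (eigenFiltration d (X s (partner s))) := fun r s hrs =>
    (hd r s hrs).1.areOpposite (hF r) (hF s) (h.isAdapted d hrs (ne_partner r))
      (h.isAdapted_neg d hrs (ne_partner s))
  have hne : ∀ r s, r ≠ s → ∀ k : ℤ, 0 ≤ k → k ≤ d →
      (X r s).eigenspace (2 * (k : K) - (d : K)) ≠ ⊥ := by
    intro r s hrs k h0 hk
    lift k to ℕ using h0
    rw [Int.cast_natCast]
    exact (hd r s hrs).2 k (by exact_mod_cast hk)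
  have h01 : (0 : Fin 4) ≠ 1 := by decide
  have h23 : (2 : Fin 4) ≠ 3 := by decide
  refine ⟨d, (hd 0 1 h01).1, (hd 2 3 h23).1, hne 0 1 h01, hne 2 3 h23, h.dolanGrady_all h01 h23,
    h.dolanGrady_all h23 h01, fun W₀ hA₀ hB₀ => ?_⟩
  by_contra! hW₀
  obtain ⟨W, ⟨hWW₀, hW, hWA, hWB⟩, hmin⟩ := exists_minimal_of_wellFoundedLT
    (fun W : Submodule K V => W ≤ W₀ ∧ W ≠ ⊥ ∧ W ≤ W.comap (X 0 1) ∧ W ≤ W.comap (X 2 3))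
    ⟨W₀, le_rfl, hW₀.1, hA₀, hB₀⟩
  have hpm : ∀ r, W ≤ W.comap (X r (partner r)) := by
    intro r
    fin_cases r
    · exact hWA
    · intro v hv
      change X 1 0 v ∈ W
      rw [h.skew 0 1 h01]
      exact neg_mem (hWA hv)
    · exact hWB
    · intro v hv
      change X 3 2 v ∈ W
      rw [h.skew 2 3 h23]
      exact neg_mem (hWB hv)
  have hpmneg : ∀ {W' : Submodule K V} {r : Fin 4}, W' ≤ W'.comap (X r (partner r)) →
      W' ≤ W'.comap (X (partner r) r) := by
    intro W' r hr v hv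
    rw [h.skew r _ (ne_partner r), Submodule.mem_comap]
    exact neg_mem (hr hv)
  have hpp : ∀ r : Fin 4, partner (partner r) = r := by decide
  -- The partner edges at `r` and `s` are, up to sign and order, `X 0 1` and `X 2 3`, so minimality
  -- may be used at any two vertices that are not partners.
  have hinv : ∀ {W' : Submodule K V} {r s : Fin 4}, s ≠ r → s ≠ partner r →
      W' ≤ W'.comap (X r (partner r)) → W' ≤ W'.comap (X s (partner s)) →
      W' ≤ W'.comap (X 0 1) ∧ W' ≤ W'.comap (X 2 3) := by
    intro W' r s h1 h2 hr hs
    have hr' := hpmneg hr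
    have hs' := hpmneg hs
    clear hpmneg hpm hpp hmin hWA hWB
    fin_cases r <;> fin_cases s <;> first
      | exact absurd rfl h1
      | exact absurd rfl h2
      | exact ⟨hr, hs⟩
      | exact ⟨hr', hs⟩
      | exact ⟨hr, hs'⟩
      | exact ⟨hr', hs'⟩
      | exact ⟨hs, hr⟩
      | exact ⟨hs', hr⟩
      | exact ⟨hs, hr'⟩
      | exact ⟨hs', hr'⟩
  have hWX : ∀ r s, r ≠ s → W ≤ W.comap (X r s) := by
    intro r s hrs
    by_cases hs : s = partner r
    · rw [hs]; exact hpm r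
    have hs' : partner r ≠ partner s := fun h1 => hrs (by rw [← hpp r, h1, hpp])
    have hneg : ∀ r, -X r (partner r) = X (partner r) (partner (partner r)) := fun r => by
      rw [hpp, h.skew r _ (ne_partner r)]
    have hle := le_antidiagonalSum_of_minimal (hd r _ (ne_partner r)).1 (hd s _ (ne_partner s)).1
      (h.dolanGrady_all (ne_partner r) (ne_partner s))
      (h.dolanGrady_all (ne_partner s) (ne_partner r)) (by
        rw [hneg, hneg]
        exact hopp _ _ hs') (hpm r) (hpm s) hW (fun W' hW' hr' hs' => by
          by_contra! hc
          obtain ⟨h1, h2⟩ := hinv hrs.symm hs hr' hs'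
          exact hc.2 (le_antisymm hW' (hmin ⟨hW'.trans hWW₀, hc.1, h1, h2⟩ hW')))
    -- `W` is the sum of its intersections with the pieces for `rs`, and `X r s` acts as a scalar on
    -- each of them.
    refine hle.trans (iSup_le fun i v hv => ?_)
    rw [Submodule.mem_comap, isSplitMap_of_isAdapted (hF r) (hF s)
      (h.isAdapted d hrs (ne_partner r)) (h.isAdapted_neg d hrs (ne_partner s)) i v hv.1.1 hv.1.2]
    exact W.smul_mem _ hv.2
  rcases hirr W hWX with h1 | h1
  · exact hW h1
  · exact hW₀.2 (top_le_iff.1 (h1 ▸ hWW₀))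

end Irreducible

section LieAlgebras

attribute [local instance 100] LieRing.ofAssociativeRing

/-! ### Presented Lie algebras -/

/-- Lift the generators into `S`; followed by the inclusion this lift fixes the generators, so it is
the identity. -/
theorem FreeLieAlgebra.mem_of_of_mem {K : Type u} {ι : Type w} [CommRing K]
    (S : LieSubalgebra K (FreeLieAlgebra K ι)) (h : ∀ i, FreeLieAlgebra.of K i ∈ S)
    (a : FreeLieAlgebra K ι) : a ∈ S := by
  let φ : FreeLieAlgebra K ι →ₗ⁅K⁆ S := FreeLieAlgebra.lift K fun i => ⟨FreeLieAlgebra.of K i, h i⟩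
  have h1 : S.incl.comp φ = LieHom.id := by
    refine FreeLieAlgebra.hom_ext fun i => ?_
    rw [LieHom.comp_apply, FreeLieAlgebra.lift_of_apply]
    rfl
  have h2 := LieHom.congr_fun h1 a
  rw [LieHom.comp_apply, LieHom.id_apply] at h2
  rw [← h2]
  exact (φ a).2

variable {K : Type u} [CommRing K]

/-- The quotient map by a Lie ideal. -/
def LieIdeal.quotientMk {L : Type w} [LieRing L] [LieAlgebra K L] (I : LieIdeal K L) :
    L →ₗ⁅K⁆ L ⧸ I :=
  { (LieSubmodule.Quotient.mk' I : L →ₗ[K] L ⧸ I) with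
    map_lie' := rfl }

theorem LieIdeal.exists_quotientLift {L : Type w} {L' : Type v} [LieRing L] [LieAlgebra K L]
    [LieRing L'] [LieAlgebra K L'] (I : LieIdeal K L) (f : L →ₗ⁅K⁆ L') (h : ∀ a ∈ I, f a = 0) :
    ∃ g : L ⧸ I →ₗ⁅K⁆ L', ∀ a, g (LieSubmodule.Quotient.mk a) = f a := by
  let g₀ : L ⧸ I →ₗ[K] L' := I.toSubmodule.liftQ (f : L →ₗ[K] L') fun a ha => h a ha
  refine ⟨{ g₀ with map_lie' := ?_ }, fun a => rfl⟩
  rintro ⟨x⟩ ⟨y⟩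
  exact f.map_lie x y

/-- A subspace of the algebra closed under the bracket and containing the generators is the
whole algebra. -/
theorem mem_of_mk_of_mem {ι : Type w} (I : LieIdeal K (FreeLieAlgebra K ι))
    (S : LieSubalgebra K (FreeLieAlgebra K ι ⧸ I))
    (h : ∀ i, LieSubmodule.Quotient.mk (FreeLieAlgebra.of K i) ∈ S)
    (a : FreeLieAlgebra K ι ⧸ I) : a ∈ S := by
  obtain ⟨b, rfl⟩ := LieSubmodule.Quotient.surjective_mk' I a
  exact FreeLieAlgebra.mem_of_of_mem (S.comap I.quotientMk) h b

theorem Onsager.mem_of_gen_mem (S : LieSubalgebra K (Onsager K)) (hX : Onsager.X K ∈ S)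
    (hY : Onsager.Y K ∈ S) (a : Onsager K) : a ∈ S :=
  mem_of_mk_of_mem (Onsager.relIdeal K) S (fun i => by fin_cases i; exacts [hX, hY]) a

theorem Tetrahedron.mem_of_gen_mem (S : LieSubalgebra K (Tetrahedron K))
    (h : ∀ r s (hrs : r ≠ s), Tetrahedron.gen K r s hrs ∈ S) (a : Tetrahedron K) : a ∈ S :=
  mem_of_mk_of_mem (Tetrahedron.relIdeal K) S (fun i => h _ _ i.2) a

theorem Onsager.dolanGrady_left :
    ⁅Onsager.X K, ⁅Onsager.X K, ⁅Onsager.X K, Onsager.Y K⁆⁆⁆ =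
      (4 : K) • ⁅Onsager.X K, Onsager.Y K⁆ :=
  sub_eq_zero.1 (LieSubmodule.Quotient.mk_eq_zero'.2
    (LieSubmodule.subset_lieSpan Onsager.IsRelator.xy) :
      (LieSubmodule.Quotient.mk (N := Onsager.relIdeal K) _ = 0))

theorem Onsager.dolanGrady_right :
    ⁅Onsager.Y K, ⁅Onsager.Y K, ⁅Onsager.Y K, Onsager.X K⁆⁆⁆ =
      (4 : K) • ⁅Onsager.Y K, Onsager.X K⁆ :=
  sub_eq_zero.1 (LieSubmodule.Quotient.mk_eq_zero'.2
    (LieSubmodule.subset_lieSpan Onsager.IsRelator.yx) :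
      (LieSubmodule.Quotient.mk (N := Onsager.relIdeal K) _ = 0))

theorem Tetrahedron.gen_skew (r s : Fin 4) (h : r ≠ s) :
    Tetrahedron.gen K s r h.symm = -Tetrahedron.gen K r s h :=
  eq_neg_of_add_eq_zero_right (LieSubmodule.Quotient.mk_eq_zero'.2
    (LieSubmodule.subset_lieSpan (Tetrahedron.IsRelator.skew r s h)) :
      (LieSubmodule.Quotient.mk (N := Tetrahedron.relIdeal K) _ = 0))

theorem Tetrahedron.gen_triangle (r s t : Fin 4) (hrs : r ≠ s) (hst : s ≠ t) (hrt : r ≠ t) :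
    ⁅Tetrahedron.gen K r s hrs, Tetrahedron.gen K s t hst⁆ =
      (2 : K) • Tetrahedron.gen K r s hrs + (2 : K) • Tetrahedron.gen K s t hst :=
  sub_eq_zero.1 (LieSubmodule.Quotient.mk_eq_zero'.2
    (LieSubmodule.subset_lieSpan (Tetrahedron.IsRelator.triangle r s t hrs hst hrt)) :
      (LieSubmodule.Quotient.mk (N := Tetrahedron.relIdeal K) _ = 0))

theorem Tetrahedron.gen_dolanGrady (r s t u : Fin 4) (hrs : r ≠ s) (hrt : r ≠ t) (hru : r ≠ u)
    (hst : s ≠ t) (hsu : s ≠ u) (htu : t ≠ u) :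
    ⁅Tetrahedron.gen K r s hrs, ⁅Tetrahedron.gen K r s hrs,
      ⁅Tetrahedron.gen K r s hrs, Tetrahedron.gen K t u htu⁆⁆⁆ =
      (4 : K) • ⁅Tetrahedron.gen K r s hrs, Tetrahedron.gen K t u htu⁆ :=
  sub_eq_zero.1 (LieSubmodule.Quotient.mk_eq_zero'.2
    (LieSubmodule.subset_lieSpan
      (Tetrahedron.IsRelator.dolanGrady r s t u hrs hrt hru hst hsu htu)) :
      (LieSubmodule.Quotient.mk (N := Tetrahedron.relIdeal K) _ = 0))

theorem Onsager.exists_hom {L : Type v} [LieRing L] [LieAlgebra K L] (A B : L)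
    (hA : ⁅A, ⁅A, ⁅A, B⁆⁆⁆ = (4 : K) • ⁅A, B⁆) (hB : ⁅B, ⁅B, ⁅B, A⁆⁆⁆ = (4 : K) • ⁅B, A⁆) :
    ∃ φ : Onsager K →ₗ⁅K⁆ L, φ (Onsager.X K) = A ∧ φ (Onsager.Y K) = B := by
  let f : FreeLieAlgebra K (Fin 2) →ₗ⁅K⁆ L := FreeLieAlgebra.lift K ![A, B]
  have h0 : f (Onsager.freeGen K 0) = A := FreeLieAlgebra.lift_of_apply _ _
  have h1 : f (Onsager.freeGen K 1) = B := FreeLieAlgebra.lift_of_apply _ _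
  have hker : Onsager.relIdeal K ≤ f.ker := by
    refine LieSubmodule.lieSpan_le.2 ?_
    rintro _ (_ | _) <;> refine (LieHom.mem_ker).2 ?_
    · simp [h0, h1, hA]
    · simp [h0, h1, hB]
  obtain ⟨g, hg⟩ := LieIdeal.exists_quotientLift (Onsager.relIdeal K) f fun a ha =>
    LieHom.mem_ker.1 (hker ha)
  exact ⟨g, (hg _).trans h0, (hg _).trans h1⟩

theorem Tetrahedron.exists_hom {L : Type v} [LieRing L] [LieAlgebra K L] (X : Fin 4 → Fin 4 → L)
    (hskew : ∀ r s, r ≠ s → X s r = -X r s)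
    (htri : ∀ r s t, r ≠ s → s ≠ t → r ≠ t → ⁅X r s, X s t⁆ = (2 : K) • X r s + (2 : K) • X s t)
    (hdg : ∀ r s t u, r ≠ s → r ≠ t → r ≠ u → s ≠ t → s ≠ u → t ≠ u →
      ⁅X r s, ⁅X r s, ⁅X r s, X t u⁆⁆⁆ = (4 : K) • ⁅X r s, X t u⁆) :
    ∃ φ : Tetrahedron K →ₗ⁅K⁆ L, ∀ r s h, φ (Tetrahedron.gen K r s h) = X r s := by
  let f : FreeLieAlgebra K Tetrahedron.Index →ₗ⁅K⁆ L :=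
    FreeLieAlgebra.lift K fun p => X p.1.1 p.1.2
  have hf : ∀ r s h, f (Tetrahedron.freeGen K r s h) = X r s := fun r s h =>
    FreeLieAlgebra.lift_of_apply _ _
  have hker : Tetrahedron.relIdeal K ≤ f.ker := by
    refine LieSubmodule.lieSpan_le.2 ?_
    rintro _ (⟨r, s, h⟩ | ⟨r, s, t, hrs, hst, hrt⟩ | ⟨r, s, t, u, hrs, hrt, hru, hst, hsu, htu⟩) <;>
      refine (LieHom.mem_ker).2 ?_
    · simp [hf, hskew r s h]
    · simp [hf, htri r s t hrs hst hrt]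
    · simp [hf, hdg r s t u hrs hrt hru hst hsu htu]
  obtain ⟨g, hg⟩ := LieIdeal.exists_quotientLift (Tetrahedron.relIdeal K) f fun a ha =>
    LieHom.mem_ker.1 (hker ha)
  exact ⟨g, fun r s h => (hg _).trans (hf r s h)⟩

theorem Tetrahedron.hom_ext {L : Type v} [LieRing L] [LieAlgebra K L] {φ ψ : Tetrahedron K →ₗ⁅K⁆ L}
    (h : ∀ r s hrs, φ (Tetrahedron.gen K r s hrs) = ψ (Tetrahedron.gen K r s hrs)) : φ = ψ := by
  let S : LieSubalgebra K (Tetrahedron K) :=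
    { LinearMap.eqLocus (φ : Tetrahedron K →ₗ[K] L) (ψ : Tetrahedron K →ₗ[K] L) with
      lie_mem' := fun {x y} (hx : φ x = ψ x) (hy : φ y = ψ y) =>
        show φ ⁅x, y⁆ = ψ ⁅x, y⁆ by rw [LieHom.map_lie, LieHom.map_lie, hx, hy] }
  exact LieHom.ext fun a => Tetrahedron.mem_of_gen_mem S h a

end LieAlgebras

section Modules

attribute [local instance 100] LieRing.ofAssociativeRing

/-! ### Module structures as homomorphisms -/

namespace LieModuleStructure

variable {K : Type u} {L : Type w} {V : Type v} [CommRing K] [LieRing L] [LieAlgebra K L]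
  [AddCommGroup V] [Module K V]

/-- The representation given by a module structure. -/
def toHom (S : LieModuleStructure K L V) : L →ₗ⁅K⁆ Module.End K V :=
  letI := S.lieRingModule
  letI := S.lieModule
  LieModule.toEnd K L V

/-- The module structure given by a representation. -/
def ofHom (φ : L →ₗ⁅K⁆ Module.End K V) : LieModuleStructure K L V where
  lieRingModule := LieRingModule.compLieHom V φ
  lieModule := LieModule.compLieHom V φ

/-- The only data in a module structure on a fixed `V` is the bracket map; the other fields are
proofs. -/
theorem ext_of_toHom {S T : LieModuleStructure K L V} (h : S.toHom = T.toHom) : S = T := by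
  obtain @⟨i, _⟩ := S
  obtain @⟨j, _⟩ := T
  have hij : i = j := by
    obtain @⟨⟨b⟩, _, _, _⟩ := i
    obtain @⟨⟨c⟩, _, _, _⟩ := j
    congr
    funext x v
    exact LinearMap.congr_fun (LieHom.congr_fun h x) v
  subst hij
  rfl

end LieModuleStructure

/-- The elements of `L` leaving `W` invariant. -/
def LieModule.subspaceStabilizer {K : Type u} (L : Type w) {V : Type v} [CommRing K] [LieRing L]
    [LieAlgebra K L] [AddCommGroup V] [Module K V] [LieRingModule L V] [LieModule K L V]
    (W : Submodule K V) : LieSubalgebra K L where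
  carrier := {a | ∀ v ∈ W, ⁅a, v⁆ ∈ W}
  add_mem' ha hb v hv := by rw [add_lie]; exact add_mem (ha v hv) (hb v hv)
  zero_mem' v _ := by rw [zero_lie]; exact W.zero_mem
  smul_mem' c a ha v hv := by rw [smul_lie]; exact W.smul_mem c (ha v hv)
  lie_mem' {a b} ha hb v hv := by
    rw [lie_lie]; exact sub_mem (ha _ (hb v hv)) (hb _ (ha v hv))

/-- The elements of `L` with whose action `f` commutes. -/
def LieModule.commutant {K : Type u} (L : Type w) {V V' : Type*} [CommRing K] [LieRing L]
    [LieAlgebra K L] [AddCommGroup V] [Module K V] [LieRingModule L V] [LieModule K L V]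
    [AddCommGroup V'] [Module K V'] [LieRingModule L V'] [LieModule K L V']
    (f : V →ₗ[K] V') : LieSubalgebra K L where
  carrier := {a | ∀ v, f ⁅a, v⁆ = ⁅a, f v⁆}
  add_mem' ha hb v := by rw [add_lie, map_add, ha, hb, add_lie]
  zero_mem' v := by rw [zero_lie, map_zero, zero_lie]
  smul_mem' c a ha v := by rw [smul_lie, map_smul, ha, smul_lie]
  lie_mem' {a b} ha hb v := by rw [lie_lie, map_sub, ha, hb, hb, ha, lie_lie]

theorem LieModule.eq_bot_or_eq_top {K : Type u} {L : Type w} {V : Type v} [CommRing K] [LieRing L]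
    [LieAlgebra K L] [AddCommGroup V] [Module K V] [LieRingModule L V] [LieModule K L V]
    [LieModule.IsIrreducible K L V] (W : Submodule K V)
    (h : ∀ a, a ∈ LieModule.subspaceStabilizer L W) : W = ⊥ ∨ W = ⊤ := by
  let N : LieSubmodule K L V := { W with lie_mem := fun {a v} hv => h a v hv }
  rcases IsSimpleOrder.eq_bot_or_eq_top N with hN | hN
  · exact Or.inl ((LieSubmodule.toSubmodule_eq_bot N).2 hN)
  · exact Or.inr ((LieSubmodule.toSubmodule_eq_top N).2 hN)

/-! ### Pairs and families of maps coming from modules -/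

variable {K : Type u} {V : Type v} [Field K] [AddCommGroup V] [Module K V]

/-- The action of the generators of the tetrahedron algebra. -/
noncomputable def tetrahedronFamily (φ : Tetrahedron K →ₗ⁅K⁆ Module.End K V) (r s : Fin 4) :
    Module.End K V :=
  if h : r ≠ s then φ (Tetrahedron.gen K r s h) else 0

theorem tetrahedronFamily_of_ne (φ : Tetrahedron K →ₗ⁅K⁆ Module.End K V) {r s : Fin 4}
    (h : r ≠ s) : tetrahedronFamily φ r s = φ (Tetrahedron.gen K r s h) :=
  dif_pos h

theorem isTetrahedronFamily_tetrahedronFamily (φ : Tetrahedron K →ₗ⁅K⁆ Module.End K V) :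
    IsTetrahedronFamily (tetrahedronFamily φ) := by
  refine ⟨fun r s h => ?_, fun r s t hrs hst hrt => ?_,
    fun r s t u hrs hrt hru hst hsu htu => ?_⟩
  · rw [tetrahedronFamily_of_ne φ h, tetrahedronFamily_of_ne φ h.symm, ← map_neg,
      Tetrahedron.gen_skew]
  · rw [tetrahedronFamily_of_ne φ hrs, tetrahedronFamily_of_ne φ hst,
      ← LieRing.of_associative_ring_bracket]
    exact (φ.map_lie _ _).symm.trans ((congrArg φ (Tetrahedron.gen_triangle r s t hrs hst hrt)).trans
      (by simp))
  · rw [tetrahedronFamily_of_ne φ hrs, tetrahedronFamily_of_ne φ htu]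
    have h := congrArg φ (Tetrahedron.gen_dolanGrady (K := K) r s t u hrs hrt hru hst hsu htu)
    simpa only [LieHom.map_lie, map_smul] using h

theorem IsTetrahedronFamily.exists_hom {X : Fin 4 → Fin 4 → Module.End K V}
    (h : IsTetrahedronFamily X) :
    ∃ φ : Tetrahedron K →ₗ⁅K⁆ Module.End K V, ∀ r s hrs, φ (Tetrahedron.gen K r s hrs) = X r s :=
  Tetrahedron.exists_hom X h.skew h.triangle h.dolanGrady

/-- Diagonalizability is not part of the type. It follows from irreducibility: by Dolan-Grady the
sum of the eigenspaces for `2k - d`, over all integers `k`, is invariant under both maps, and it is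
nonzero. -/
theorem isOnsagerPair_of_hasTypeDiameter [CharZero K] [LieRingModule (Onsager K) V]
    [LieModule K (Onsager K) V] [LieModule.IsIrreducible K (Onsager K) V] {d : ℕ}
    (h : Onsager.HasTypeDiameter K V 0 0 d) :
    IsOnsagerPair d (LieModule.toEnd K (Onsager K) V (Onsager.X K))
      (LieModule.toEnd K (Onsager K) V (Onsager.Y K)) := by
  set A := LieModule.toEnd K (Onsager K) V (Onsager.X K) with hA
  set B := LieModule.toEnd K (Onsager K) V (Onsager.Y K) with hB
  have hAB : ⁅A, ⁅A, ⁅A, B⁆⁆⁆ = (4 : K) • ⁅A, B⁆ := by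
    have h1 := congrArg (LieModule.toEnd K (Onsager K) V) (Onsager.dolanGrady_left (K := K))
    simpa only [LieHom.map_lie, map_smul] using h1
  have hBA : ⁅B, ⁅B, ⁅B, A⁆⁆⁆ = (4 : K) • ⁅B, A⁆ := by
    have h1 := congrArg (LieModule.toEnd K (Onsager K) V) (Onsager.dolanGrady_right (K := K))
    simpa only [LieHom.map_lie, map_smul] using h1
  have hirr : ∀ W : Submodule K V, W ≤ W.comap A → W ≤ W.comap B → W = ⊥ ∨ W = ⊤ :=
    fun W hWA hWB => LieModule.eq_bot_or_eq_top (L := Onsager K) W fun a =>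
      Onsager.mem_of_gen_mem (LieModule.subspaceStabilizer _ W) (fun _ hv => hWA hv)
        (fun _ hv => hWB hv) a
  have hne : ∀ {C : Module.End K V},
      {μ : K | C.HasEigenvalue μ} = {μ : K | ∃ i : ℕ, i ≤ d ∧ μ = (d : K) - 2 * (i : K) + 0} →
      ∀ k : ℤ, 0 ≤ k → k ≤ d → C.eigenspace (2 * (k : K) - (d : K)) ≠ ⊥ := by
    intro C hC k h0 hk
    lift k to ℕ using h0
    have hk' : k ≤ d := by exact_mod_cast hk
    have h1 : (2 * (k : K) - (d : K)) ∈ {μ : K | C.HasEigenvalue μ} := by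
      rw [hC]
      refine ⟨d - k, by lia, ?_⟩
      rw [Nat.cast_sub hk']
      ring
    rw [Int.cast_natCast]
    exact h1
  have hgr : ∀ {C D : Module.End K V},
      {μ : K | C.HasEigenvalue μ} = {μ : K | ∃ i : ℕ, i ≤ d ∧ μ = (d : K) - 2 * (i : K) + 0} →
      ⁅C, ⁅C, ⁅C, D⁆⁆⁆ = (4 : K) • ⁅C, D⁆ →
      (∀ W : Submodule K V, W ≤ W.comap C → W ≤ W.comap D → W = ⊥ ∨ W = ⊤) → IsGraded d C := by
    intro C D hC hCD hirr
    refine ⟨(hirr _ (iSup_le fun k v hv => ?_) (iSup_le fun k v hv => ?_)).resolve_left ?_,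
      fun k hk => ?_⟩
    · rw [Submodule.mem_comap, Module.End.mem_eigenspace_iff.1 hv]
      exact Submodule.smul_mem _ _
        (le_iSup (fun k : ℤ => C.eigenspace (2 * (k : K) - (d : K))) k hv)
    · rw [Submodule.mem_comap]
      refine SetLike.le_def.1 (sup_le (sup_le ?_ (le_iSup
        (fun k : ℤ => C.eigenspace (2 * (k : K) - (d : K))) k)) ?_) (apply_mem_of_dolanGrady hCD hv)
      · convert le_iSup (fun k : ℤ => C.eigenspace (2 * (k : K) - (d : K))) (k - 1) using 2
        push_cast; ring
      · convert le_iSup (fun k : ℤ => C.eigenspace (2 * (k : K) - (d : K))) (k + 1) using 2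
        push_cast; ring
    · intro hbot
      refine hne hC 0 le_rfl (by lia) (eq_bot_iff.2 ?_)
      rw [← hbot]
      exact le_iSup (fun k : ℤ => C.eigenspace (2 * (k : K) - (d : K))) 0
    · by_contra hk'
      have h1 : (2 * (k : K) - (d : K)) ∈ {μ : K | C.HasEigenvalue μ} := hk'
      rw [hC] at h1
      obtain ⟨i, hi, hi'⟩ := h1
      have h2 : (2 : K) * (k : K) = 2 * (((d : ℤ) - i : ℤ) : K) := by
        push_cast
        linear_combination hi'
      have h3 : k = (d : ℤ) - i := by exact_mod_cast mul_left_cancel₀ two_ne_zero h2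
      lia
  exact ⟨hgr h.1 hAB hirr, hgr h.2 hBA fun W hB hA => hirr W hA hB, hne h.1, hne h.2, hAB, hBA,
    hirr⟩

theorem IsOnsagerPair.nontrivial {d : ℕ} {A B : Module.End K V} (h : IsOnsagerPair d A B) :
    Nontrivial V := by
  obtain ⟨v, -, hv⟩ := (Submodule.ne_bot_iff _).1 (h.left_ne_bot 0 le_rfl (by lia))
  exact ⟨⟨v, 0, hv⟩⟩

theorem IsOnsagerPair.isIrreducible {d : ℕ} {A B : Module.End K V} (h : IsOnsagerPair d A B)
    {L : Type w} [LieRing L] [LieAlgebra K L] (S : LieModuleStructure K L V) {x y : L}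
    (hx : S.act x = A) (hy : S.act y = B) : S.IsIrreducible := by
  let := S.lieRingModule
  let := S.lieModule
  have := h.nontrivial
  refine LieModule.IsIrreducible.mk (R := K) (L := L) (M := V) fun N hN => ?_
  refine (LieSubmodule.toSubmodule_eq_top N).1
    ((h.irreducible N.toSubmodule (fun v hv => ?_) fun v hv => ?_).resolve_left fun h0 =>
      hN ((LieSubmodule.toSubmodule_eq_bot N).1 h0))
  · rw [← hx]; exact N.lie_mem hv
  · rw [← hy]; exact N.lie_mem hv

theorem IsOnsagerPair.exists_structure [CharZero K] {d : ℕ} {A B : Module.End K V}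
    (h : IsOnsagerPair d A B) : ∃ S : LieModuleStructure K (Tetrahedron K) V,
      S.act (Tetrahedron.X01 K) = A ∧ S.act (Tetrahedron.X23 K) = B := by
  obtain ⟨X, hX, hA, hB⟩ := h.exists_isTetrahedronFamily
  obtain ⟨φ, hφ⟩ := hX.exists_hom
  exact ⟨.ofHom φ, (hφ 0 1 (by decide)).trans hA, (hφ 2 3 (by decide)).trans hB⟩

theorem IsOnsagerPair.structure_unique [CharZero K] {d : ℕ} {A B : Module.End K V}
    (h : IsOnsagerPair d A B) {S T : LieModuleStructure K (Tetrahedron K) V}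
    (hS : S.act (Tetrahedron.X01 K) = A ∧ S.act (Tetrahedron.X23 K) = B)
    (hT : T.act (Tetrahedron.X01 K) = A ∧ T.act (Tetrahedron.X23 K) = B) : S = T := by
  have h01 : (0 : Fin 4) ≠ 1 := by decide
  have h23 : (2 : Fin 4) ≠ 3 := by decide
  have hA : ∀ {S : LieModuleStructure K (Tetrahedron K) V}, S.act (Tetrahedron.X01 K) = A →
      tetrahedronFamily S.toHom 0 1 = A := fun h => (tetrahedronFamily_of_ne _ h01).trans h
  have hB : ∀ {S : LieModuleStructure K (Tetrahedron K) V}, S.act (Tetrahedron.X23 K) = B →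
      tetrahedronFamily S.toHom 2 3 = B := fun h => (tetrahedronFamily_of_ne _ h23).trans h
  refine LieModuleStructure.ext_of_toHom (Tetrahedron.hom_ext fun r s hrs => ?_)
  rw [← tetrahedronFamily_of_ne, ← tetrahedronFamily_of_ne]
  refine IsOnsagerPair.eq_of_isTetrahedronFamily (d := d) ?_
    (isTetrahedronFamily_tetrahedronFamily _) (isTetrahedronFamily_tetrahedronFamily _) ?_ ?_ hrs
  · rwa [hA hS.1, hB hS.2]
  · rw [hA hS.1, hA hT.1]
  · rw [hB hS.2, hB hT.2]

/-- One direction is uniqueness of adapted maps applied to every edge; the other needs only edges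
`01` and `23`, whose flag maps are `A` and `B`. -/
theorem IsOnsagerPair.act_eq_iff_isFlagMap [CharZero K] {d : ℕ} {A B : Module.End K V}
    (h : IsOnsagerPair d A B) (S : LieModuleStructure K (Tetrahedron K) V) :
    (S.act (Tetrahedron.X01 K) = A ∧ S.act (Tetrahedron.X23 K) = B) ↔
      ∀ (r s : Fin 4) (h : r ≠ s),
        IsFlagMap (pairFlag A B d r) (pairFlag A B d s) (S.act (Tetrahedron.gen K r s h)) := by
  refine ⟨fun hS r s hrs => ?_, fun hS => h.eq_of_isFlagMap (hS 0 1 _) (hS 2 3 _)⟩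
  have hX := isTetrahedronFamily_tetrahedronFamily S.toHom
  have h01 : tetrahedronFamily S.toHom 0 1 = A :=
    (tetrahedronFamily_of_ne _ (by decide)).trans hS.1
  have h23 : tetrahedronFamily S.toHom 2 3 = B :=
    (tetrahedronFamily_of_ne _ (by decide)).trans hS.2
  have h1 := IsOnsagerPair.isSplitMap (d := d) hX (by rwa [h01, h23]) hrs
  rw [h01, h23, tetrahedronFamily_of_ne _ hrs] at h1
  exact (h.isFlagMap_pairFlag_iff hrs).2 h1

/-- The restriction of an irreducible tetrahedron module to the edges `01` and `23`. -/
theorem exists_isOnsagerPair_of_isIrreducible [IsAlgClosed K] [CharZero K] [FiniteDimensional K V]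
    [LieRingModule (Tetrahedron K) V] [LieModule K (Tetrahedron K) V]
    [LieModule.IsIrreducible K (Tetrahedron K) V] :
    ∃ d : ℕ, IsOnsagerPair d (LieModule.toEnd K (Tetrahedron K) V (Tetrahedron.X01 K))
      (LieModule.toEnd K (Tetrahedron K) V (Tetrahedron.X23 K)) := by
  have := LieModule.nontrivial_of_isIrreducible K (Tetrahedron K) V
  have h := (isTetrahedronFamily_tetrahedronFamily
    (LieModule.toEnd K (Tetrahedron K) V)).exists_isOnsagerPair fun W hW =>
      LieModule.eq_bot_or_eq_top (L := Tetrahedron K) W fun a =>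
        Tetrahedron.mem_of_gen_mem (LieModule.subspaceStabilizer _ W) (fun r s hrs v hv => by
          have h1 := hW r s hrs hv
          rw [tetrahedronFamily_of_ne _ hrs] at h1
          exact h1) a
  rwa [tetrahedronFamily_of_ne _ (by decide), tetrahedronFamily_of_ne _ (by decide)] at h

theorem IsOnsagerPair.hasTypeDiameter {d : ℕ} {A B : Module.End K V} (h : IsOnsagerPair d A B)
    [LieRingModule (Onsager K) V] [LieModule K (Onsager K) V]
    (hA : LieModule.toEnd K (Onsager K) V (Onsager.X K) = A)
    (hB : LieModule.toEnd K (Onsager K) V (Onsager.Y K) = B) :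
    Onsager.HasTypeDiameter K V 0 0 d := by
  have key : ∀ {C : Module.End K V}, IsGraded d C →
      (∀ k : ℤ, 0 ≤ k → k ≤ d → C.eigenspace (2 * (k : K) - (d : K)) ≠ ⊥) →
      {μ : K | C.HasEigenvalue μ} = {μ : K | ∃ i : ℕ, i ≤ d ∧ μ = (d : K) - 2 * (i : K) + 0} := by
    intro C hC hne
    ext μ
    constructor
    · intro hμ
      obtain ⟨k, hk, rfl⟩ := hC.exists_of_hasEigenvalue hμ
      refine ⟨d - k, by lia, ?_⟩
      rw [Nat.cast_sub hk]
      ring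
    · rintro ⟨i, hi, rfl⟩
      have h1 := hne (d - i) (by lia) (by lia)
      have h2 : (2 : K) * (((d : ℤ) - i : ℤ) : K) - (d : K) = d - 2 * i + 0 := by
        push_cast; ring
      rw [h2] at h1
      exact h1
  exact ⟨hA ▸ key h.left h.left_ne_bot, hB ▸ key h.right h.right_ne_bot⟩

end Modules

/-! ### Isomorphism classes -/

section IsoClasses

/-- A relation between two types inducing a bijection between the quotients. -/
theorem exists_quotient_equiv {α : Type u} {β : Type v} (s : Setoid α) (t : Setoid β)
    (R : α → β → Prop) (hα : ∀ a, ∃ b, R a b) (hβ : ∀ b, ∃ a, R a b)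
    (hs : ∀ a a' b, s a a' → R a b → R a' b) (ht : ∀ a b b', t b b' → R a b → R a b')
    (hs' : ∀ a a' b, R a b → R a' b → s a a') (ht' : ∀ a b b', R a b → R a b' → t b b') :
    ∃ Φ : Quotient s ≃ Quotient t, ∀ a b, Φ (Quotient.mk s a) = Quotient.mk t b ↔ R a b := by
  choose f hf using hα
  let F : Quotient s → Quotient t := Quotient.lift (fun a => Quotient.mk t (f a))
    fun a a' h => Quotient.sound (ht' a' _ _ (hs a a' _ h (hf a)) (hf a'))
  have hF : ∀ a b, F (Quotient.mk s a) = Quotient.mk t b ↔ R a b := fun a b =>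
    ⟨fun h => ht a _ b (Quotient.exact h) (hf a), fun h => Quotient.sound (ht' a _ b (hf a) h)⟩
  refine ⟨Equiv.ofBijective F ⟨?_, ?_⟩, hF⟩
  · rintro ⟨a⟩ ⟨a'⟩ h
    exact Quotient.sound (hs' a a' (f a') ((hF a (f a')).1 h) (hf a'))
  · rintro ⟨b⟩
    obtain ⟨a, ha⟩ := hβ b
    exact ⟨Quotient.mk s a, (hF a b).2 ha⟩

variable {K : Type u} [Field K]

/-- `f` intertwines the actions of `X, Y` with those of `X_{01}, X_{23}`. -/
def Intertwines (U : Type*) (V : Type*) [AddCommGroup U] [Module K U] [LieRingModule (Onsager K) U]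
    [LieModule K (Onsager K) U] [AddCommGroup V] [Module K V] [LieRingModule (Tetrahedron K) V]
    [LieModule K (Tetrahedron K) V] (f : U ≃ₗ[K] V) : Prop :=
  ∀ a : U, f ⁅Onsager.X K, a⁆ = ⁅Tetrahedron.X01 K, f a⁆ ∧
    f ⁅Onsager.Y K, a⁆ = ⁅Tetrahedron.X23 K, f a⁆

attribute [local instance 100] LieRing.ofAssociativeRing

/-- The isomorphism of modules given by a linear bijection commuting with the action. -/
def LinearEquiv.toLieModuleEquiv {L : Type w} {M N : Type*} [LieRing L] [LieAlgebra K L]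
    [AddCommGroup M] [Module K M] [LieRingModule L M] [LieModule K L M]
    [AddCommGroup N] [Module K N] [LieRingModule L N] [LieModule K L N] (f : M ≃ₗ[K] N)
    (h : ∀ a : L, a ∈ LieModule.commutant L (f : M →ₗ[K] N)) : M ≃ₗ⁅K, L⁆ N :=
  { f with map_lie' := fun {a v} => h a v }

/-- The structure on `U` transported from `V` along `f`. -/
def LieModuleStructure.transport {L : Type w} {U V : Type*} [LieRing L] [LieAlgebra K L]
    [AddCommGroup U] [Module K U] [AddCommGroup V] [Module K V] [LieRingModule L V]
    [LieModule K L V] (f : U ≃ₗ[K] V) : LieModuleStructure K L U :=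
  .ofHom ((f.symm.lieConj : Module.End K V →ₗ⁅K⁆ Module.End K U).comp (LieModule.toEnd K L V))

theorem LieModuleStructure.transport_act {L : Type w} {U V : Type*} [LieRing L] [LieAlgebra K L]
    [AddCommGroup U] [Module K U] [AddCommGroup V] [Module K V] [LieRingModule L V]
    [LieModule K L V] (f : U ≃ₗ[K] V) (x : L) (u : U) :
    (LieModuleStructure.transport f : LieModuleStructure K L U).act x u = f.symm ⁅x, f u⁆ := rfl

theorem onsagerIrr_equiv_of_intertwines (U U' : OnsagerIrr.{u, v} K) (V : TetrahedronIrr.{u, v} K)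
    {f : U.1.carrier ≃ₗ[K] V.carrier} {f' : U'.1.carrier ≃ₗ[K] V.carrier}
    (hf : Intertwines _ _ f) (hf' : Intertwines _ _ f') :
    Nonempty (U.1.carrier ≃ₗ⁅K, Onsager K⁆ U'.1.carrier) := by
  refine ⟨(f.trans f'.symm).toLieModuleEquiv fun a =>
    Onsager.mem_of_gen_mem (LieModule.commutant _ _) (fun v => ?_) (fun v => ?_) a⟩
  · change f'.symm (f ⁅Onsager.X K, v⁆) = ⁅Onsager.X K, f'.symm (f v)⁆
    rw [LinearEquiv.symm_apply_eq, (hf v).1, (hf' _).1, LinearEquiv.apply_symm_apply]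
  · change f'.symm (f ⁅Onsager.Y K, v⁆) = ⁅Onsager.Y K, f'.symm (f v)⁆
    rw [LinearEquiv.symm_apply_eq, (hf v).2, (hf' _).2, LinearEquiv.apply_symm_apply]

variable [CharZero K]

/-- `X 0 1` and `X 2 3` are not assumed to generate the algebra, so generators alone do not suffice.
Both structures are transported to `U`, where they extend the same pair and hence coincide. -/
theorem tetrahedronIrr_equiv_of_intertwines (U : OnsagerIrr.{u, v} K)
    (V V' : TetrahedronIrr.{u, v} K)
    {f : U.1.carrier ≃ₗ[K] V.carrier} {f' : U.1.carrier ≃ₗ[K] V'.carrier}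
    (hf : Intertwines _ _ f) (hf' : Intertwines _ _ f') :
    Nonempty (V.carrier ≃ₗ⁅K, Tetrahedron K⁆ V'.carrier) := by
  obtain ⟨d, hd⟩ := U.2
  have hAB := isOnsagerPair_of_hasTypeDiameter hd
  have key : ∀ {V : TetrahedronIrr.{u, v} K} {f : U.1.carrier ≃ₗ[K] V.carrier},
      Intertwines _ _ f →
      (LieModuleStructure.transport f : LieModuleStructure K (Tetrahedron K) U.1.carrier).act
          (Tetrahedron.X01 K) = LieModule.toEnd K (Onsager K) U.1.carrier (Onsager.X K) ∧
        (LieModuleStructure.transport f : LieModuleStructure K (Tetrahedron K) U.1.carrier).act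
          (Tetrahedron.X23 K) = LieModule.toEnd K (Onsager K) U.1.carrier (Onsager.Y K) := by
    intro V f hf
    constructor <;> ext u <;>
      rw [LieModuleStructure.transport_act, LinearEquiv.symm_apply_eq]
    exacts [(hf u).1.symm, (hf u).2.symm]
  have hST := hAB.structure_unique (key hf) (key hf')
  refine ⟨(f.symm.trans f').toLieModuleEquiv fun a v => ?_⟩
  have h1 := LinearMap.congr_fun (congrArg (fun S => S.act a) hST) (f.symm v)
  simp only [LieModuleStructure.transport_act, LinearEquiv.apply_symm_apply] at h1
  simp [h1]

theorem exists_tetrahedronIrr_intertwines (U : OnsagerIrr.{u, v} K) :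
    ∃ (V : TetrahedronIrr.{u, v} K) (f : U.1.carrier ≃ₗ[K] V.carrier), Intertwines _ _ f := by
  obtain ⟨d, hd⟩ := U.2
  have hAB := isOnsagerPair_of_hasTypeDiameter hd
  obtain ⟨S, hA, hB⟩ := hAB.exists_structure
  let i1 := S.lieRingModule
  let i2 := S.lieModule
  have i3 : LieModule.IsIrreducible K (Tetrahedron K) U.1.carrier := hAB.isIrreducible S hA hB
  refine ⟨{ carrier := U.1.carrier }, LinearEquiv.refl K _, fun a =>
    ⟨(LinearMap.congr_fun hA a).symm, (LinearMap.congr_fun hB a).symm⟩⟩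

theorem exists_onsagerIrr_intertwines [IsAlgClosed K] (V : TetrahedronIrr.{u, v} K) :
    ∃ (U : OnsagerIrr.{u, v} K) (f : U.1.carrier ≃ₗ[K] V.carrier), Intertwines _ _ f := by
  obtain ⟨d, hAB⟩ := exists_isOnsagerPair_of_isIrreducible (K := K) (V := V.carrier)
  obtain ⟨φ, hA, hB⟩ := Onsager.exists_hom _ _ hAB.dolanGrady_left hAB.dolanGrady_right
  let S := LieModuleStructure.ofHom φ
  let i1 := S.lieRingModule
  let i2 := S.lieModule
  have i3 : LieModule.IsIrreducible K (Onsager K) V.carrier := hAB.isIrreducible S hA hB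
  have htype : Onsager.HasTypeDiameter K V.carrier 0 0 d := hAB.hasTypeDiameter hA hB
  refine ⟨⟨{ carrier := V.carrier }, d, htype⟩, LinearEquiv.refl K _, fun a =>
    ⟨LinearMap.congr_fun hA a, LinearMap.congr_fun hB a⟩⟩

theorem exists_isoClass_equiv [IsAlgClosed K] :
    ∃ Φ : OnsagerIsoClass.{u, v} K ≃ TetrahedronIsoClass.{u, v} K,
      ∀ (U : OnsagerIrr.{u, v} K) (V : TetrahedronIrr.{u, v} K),
        Φ (Quotient.mk _ U) = Quotient.mk _ V ↔
          ∃ f : U.1.carrier ≃ₗ[K] V.carrier, Intertwines _ _ f := by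
  refine exists_quotient_equiv _ _
    (fun (U : OnsagerIrr.{u, v} K) (V : TetrahedronIrr.{u, v} K) =>
      ∃ f : U.1.carrier ≃ₗ[K] V.carrier, Intertwines _ _ f)
    exists_tetrahedronIrr_intertwines exists_onsagerIrr_intertwines ?_ ?_ ?_ ?_
  · rintro U U' V ⟨e⟩ ⟨f, hf⟩
    refine ⟨e.symm.toLinearEquiv.trans f, fun a => ?_⟩
    change f (e.symm ⁅_, a⁆) = ⁅_, f (e.symm a)⁆ ∧ f (e.symm ⁅_, a⁆) = ⁅_, f (e.symm a)⁆
    have h := fun x => LieModuleHom.map_lie e.symm.toLieModuleHom x a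
    exact ⟨(congrArg f (h _)).trans (hf _).1, (congrArg f (h _)).trans (hf _).2⟩
  · rintro U V V' ⟨e⟩ ⟨f, hf⟩
    refine ⟨f.trans e.toLinearEquiv, fun a => ?_⟩
    change e (f ⁅_, a⁆) = ⁅_, e (f a)⁆ ∧ e (f ⁅_, a⁆) = ⁅_, e (f a)⁆
    rw [(hf a).1, (hf a).2]
    exact ⟨LieModuleHom.map_lie e.toLieModuleHom _ _, LieModuleHom.map_lie e.toLieModuleHom _ _⟩
  · rintro U U' V ⟨f, hf⟩ ⟨f', hf'⟩
    exact onsagerIrr_equiv_of_intertwines U U' V hf hf'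
  · rintro U V V' ⟨f, hf⟩ ⟨f', hf'⟩
    exact tetrahedronIrr_equiv_of_intertwines U V V' hf hf'

end IsoClasses

/-! ### The main theorem -/

theorem theorem1p6 (K : Type u) [Field K] [IsAlgClosed K] [CharZero K] :
    -- every finite-dimensional irreducible Onsager module of type (0,0) and diameter d
    (∀ (V : Type v) [AddCommGroup V] [Module K V] [FiniteDimensional K V]
        [LieRingModule (Onsager K) V] [LieModule K (Onsager K) V]
        [LieModule.IsIrreducible K (Onsager K) V]
        (d : ℕ) (_ : Onsager.HasTypeDiameter K V 0 0 d)
        (A B : Module.End K V)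
        (_ : A = LieModule.toEnd K (Onsager K) V (Onsager.X K))
        (_ : B = LieModule.toEnd K (Onsager K) V (Onsager.Y K)),
      -- unique extension to a tetrahedron module structure
      (∃! S : LieModuleStructure K (Tetrahedron K) V,
        S.act (Tetrahedron.X01 K) = A ∧ S.act (Tetrahedron.X23 K) = B) ∧
      -- which is irreducible
      (∀ S : LieModuleStructure K (Tetrahedron K) V,
        S.act (Tetrahedron.X01 K) = A → S.act (Tetrahedron.X23 K) = B → S.IsIrreducible) ∧
      -- the tridiagonal pair and its four mutually opposite flags
      IsTridiagonalPair A B ∧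
      (∀ r : Fin 4, IsFlag (pairFlag A B d r)) ∧
      (∀ r s : Fin 4, r ≠ s → OppositeFlags (pairFlag A B d r) (pairFlag A B d s)) ∧
      -- the maps x_{rs}, and the tetrahedron module structure given by them
      (∀ r s : Fin 4, r ≠ s →
        ∃! x : Module.End K V, IsFlagMap (pairFlag A B d r) (pairFlag A B d s) x) ∧
      (∃! S : LieModuleStructure K (Tetrahedron K) V,
        ∀ (r s : Fin 4) (h : r ≠ s),
          IsFlagMap (pairFlag A B d r) (pairFlag A B d s) (S.act (Tetrahedron.gen K r s h))) ∧
      -- the two module structures are the same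
      (∀ S : LieModuleStructure K (Tetrahedron K) V,
        (S.act (Tetrahedron.X01 K) = A ∧ S.act (Tetrahedron.X23 K) = B) ↔
        ∀ (r s : Fin 4) (h : r ≠ s),
          IsFlagMap (pairFlag A B d r) (pairFlag A B d s) (S.act (Tetrahedron.gen K r s h)))) ∧
    -- the bijection between isomorphism classes
    (∃ Φ : OnsagerIsoClass.{u, v} K ≃ TetrahedronIsoClass.{u, v} K,
      ∀ (U : OnsagerIrr.{u, v} K) (V : TetrahedronIrr.{u, v} K),
        Φ (Quotient.mk _ U) = Quotient.mk _ V ↔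
          ∃ f : U.1.carrier ≃ₗ[K] V.carrier, ∀ a : U.1.carrier,
            f ⁅Onsager.X K, a⁆ = ⁅Tetrahedron.X01 K, f a⁆ ∧
            f ⁅Onsager.Y K, a⁆ = ⁅Tetrahedron.X23 K, f a⁆) := by
  refine ⟨?_, exists_isoClass_equiv⟩
  rintro V _ _ _ _ _ _ d hd A B rfl rfl
  have h := isOnsagerPair_of_hasTypeDiameter hd
  obtain ⟨S, hS⟩ := h.exists_structure
  refine ⟨⟨S, hS, fun T hT => h.structure_unique hT hS⟩, fun T hA hB => h.isIrreducible T hA hB,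
    h.isTridiagonalPair, h.isFlag_pairFlag, fun r s => h.oppositeFlags_pairFlag,
    fun r s => h.existsUnique_isFlagMap,
    ⟨S, (h.act_eq_iff_isFlagMap S).1 hS, fun T hT =>
      h.structure_unique ((h.act_eq_iff_isFlagMap T).2 hT) hS⟩, h.act_eq_iff_isFlagMap⟩
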